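/- All Lie algebras are real and finite-dimensional. A Hermitian structure $(J,\langle\cdot,\cdot\rangle)$ on a Lie algebra $\mathfrak g$ consists of an endomorphism $J$ with $J^2=-\mathrm{Id}$ and $[Jx,Jy]-[x,y]-J([Jx,y]+[x,Jy])=0$ for all $x,y$, and an inner product with $\langle Jx,Jy\rangle=\langle x,y\rangle$; its fundamental $2$-form is $\omega(x,y)=\langle Jx,y\rangle$. Let $d$ be the Chevalley–Eilenberg differential (trivial coefficients) and $\nabla$ the Levi-Civita connection of $\langle\cdot,\cdot\rangle$ on $\mathfrak g$. The structure is Kähler if $d\omega=0$, Kähler flat if moreover $\nabla$ has zero curvature, and Vaisman with Lee form $\theta\in\mathfrak g^*$ if $d\theta=0$, $d\omega=\theta\wedge\omega$ and $\nabla\theta=0$. For a closed $2$-form $\beta$ on a Lie algebra $\mathfrak h$, the central extension $\mathfrak h_\beta(\xi)$ is the vector space $\mathbb R\xi\oplus\mathfrak h$ with the bracket $[x,y]_\beta=\beta(x,y)\xi+[x,y]_{\mathfrak h}$, $[\xi,x]_\beta=0$ for $x,y\in\mathfrak h$; for a derivation $D$ of $\mathfrak h_\beta(\xi)$, the double extension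 is $\mathfrak h(D,\beta)=\mathbb R\ltimes_D\mathfrak h_\beta(\xi)$. **Theorem.** Let $\mathfrak g$ be a unimodular solvable Lie algebra (i.e. $\operatorname{tr}\operatorname{ad}_x=0$ for all $x\in\mathfrak g$) with a Vaisman structure $(J,\langle\cdot,\cdot\rangle)$, fundamental $2$-form $\omega$ and Lee form $\theta$, let $A\in\mathfrak g$ be the metric dual of $\theta$, that is $\theta=\langle A,\cdot\rangle$, and assume $|A|=1$. Then the centre of the ideal $\ker\theta$ is $\mathbb R\,JA$, and on the subspace $\mathfrak k:=\operatorname{span}\{A,JA\}^\perp$ there is a Lie bracket $[\cdot,\cdot]_{\mathfrak k}$ with the following properties. 1. $\mathfrak k$ with $J|_{\mathfrak k}$ and the restricted inner product is a Kähler flat Lie algebra, with fundamental $2$-form $\omega'=\omega|_{\mathfrak k\times\mathfrak k}$. 2. $\ker\theta=\mathfrak k_{\omega'}(JA)$: the linear map that sends $\xi$ to $JA$ and is the inclusion on $\mathfrak k$ is an isomorphism of Lie algebras from $\mathfrak k_{\omega'}(\xi)$ onto $\ker\theta$. 3. $\mathfrak g=\mathfrak k(D,\omega')$ with $D=\operatorname{ad}_A|_{\ker\theta}$: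 identifying $\ker\theta$ with $\mathfrak k_{\omega'}(\xi)$ as in 2, the linear map that sends the generator of $\mathbb R$ to $A$ and is the inclusion on $\ker\theta$ is an isomorphism of Lie algebras from $\mathfrak k(D,\omega')$ onto $\mathfrak g$. 4. $D$ preserves $\mathfrak k$, and $D'=D|_{\mathfrak k}$ is a derivation of $(\mathfrak k,[\cdot,\cdot]_{\mathfrak k})$ that is skew-symmetric and commutes with $J|_{\mathfrak k}$. -/

import Mathlib

universe u

namespace VaismanLie

section Metric

variable {g : Type u} [LieRing g] [LieAlgebra ℝ g]

/-- A Lie algebra is unimodular if `tr (ad x) = 0` for all `x`. -/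
def IsUnimodular (g : Type u) [LieRing g] [LieAlgebra ℝ g] : Prop :=
  ∀ x : g, LinearMap.trace ℝ g (LieAlgebra.ad ℝ g x) = 0

/-- `B` is an inner product: a symmetric, positive definite bilinear form. -/
structure IsInnerProduct (B : LinearMap.BilinForm ℝ g) : Prop where
  symm : ∀ x y, B x y = B y x
  pos : ∀ x, x ≠ 0 → 0 < B x x

/-- `nabla` (with `nabla x y` standing for `∇_x y`) is the Levi-Civita connection of the
left-invariant metric `B`: it is torsion-free and metric. -/
structure IsLeviCivita (B : LinearMap.BilinForm ℝ g) (nabla : g →ₗ[ℝ] g →ₗ[ℝ] g) : Prop where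
  torsion_free : ∀ x y, nabla x y - nabla y x = ⁅x, y⁆
  metric : ∀ x y z, B (nabla x y) z + B y (nabla x z) = 0

theorem IsLeviCivita.koszul {B : LinearMap.BilinForm ℝ g} (hB : IsInnerProduct B)
    {nabla : g →ₗ[ℝ] g →ₗ[ℝ] g} (h : IsLeviCivita B nabla) (x y z : g) :
    B (nabla x y) z = 1 / 2 * (B ⁅x, y⁆ z - B ⁅y, z⁆ x + B ⁅z, x⁆ y) := by
  have e1 := h.metric x y z
  have e2 := h.metric y z x
  have e3 := h.metric z x y
  rw [← h.torsion_free x y, ← h.torsion_free y z, ← h.torsion_free z x]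
  simp only [map_sub, LinearMap.sub_apply]
  rw [hB.symm y] at e1
  rw [hB.symm z] at e2
  rw [hB.symm x] at e3
  linarith

theorem IsInnerProduct.nondegenerate {B : LinearMap.BilinForm ℝ g} (hB : IsInnerProduct B) :
    B.Nondegenerate := by
  constructor
  · intro x hx
    by_contra h
    exact (hB.pos x h).ne' (hx x)
  · intro x hx
    by_contra h
    exact (hB.pos x h).ne' (hx x)

/-- On a finite-dimensional metric Lie algebra the Levi-Civita connection exists and is unique. -/
theorem IsInnerProduct.existsUnique_leviCivita [FiniteDimensional ℝ g]
    {B : LinearMap.BilinForm ℝ g} (hB : IsInnerProduct B) :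
    ∃! nabla : g →ₗ[ℝ] g →ₗ[ℝ] g, IsLeviCivita B nabla := by
  have key : ∀ x y : g, (∀ z, B x z = B y z) → x = y := by
    intro x y h
    have h0 : ∀ z, B (x - y) z = 0 := fun z => by
      rw [map_sub, LinearMap.sub_apply, h z, sub_self]
    by_contra hne
    exact (hB.pos (x - y) (sub_ne_zero.2 hne)).ne' (h0 _)
  let kz : g → g → Module.Dual ℝ g := fun x y =>
    { toFun := fun z => 1 / 2 * (B ⁅x, y⁆ z - B ⁅y, z⁆ x + B ⁅z, x⁆ y)
      map_add' := fun z w => by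
        simp only [map_add, lie_add, add_lie, LinearMap.add_apply]; ring
      map_smul' := fun c z => by
        simp only [map_smul, lie_smul, smul_lie, LinearMap.smul_apply, smul_eq_mul,
          RingHom.id_apply]
        ring }
  let N : g → g → g := fun x y => (LinearMap.BilinForm.toDual B hB.nondegenerate).symm (kz x y)
  have hN : ∀ x y z, B (N x y) z = 1 / 2 * (B ⁅x, y⁆ z - B ⁅y, z⁆ x + B ⁅z, x⁆ y) := by
    intro x y z
    exact LinearMap.BilinForm.apply_toDual_symm_apply (hB := hB.nondegenerate) (kz x y) z
  let nabla : g →ₗ[ℝ] g →ₗ[ℝ] g := LinearMap.mk₂ ℝ N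
    (fun x y w => key _ _ fun z => by
      simp only [map_add, LinearMap.add_apply, hN, add_lie, lie_add]; ring)
    (fun c x y => key _ _ fun z => by
      simp only [map_smul, LinearMap.smul_apply, hN, smul_lie, lie_smul, smul_eq_mul]; ring)
    (fun x y w => key _ _ fun z => by
      simp only [map_add, LinearMap.add_apply, hN, add_lie, lie_add]; ring)
    (fun c x y => key _ _ fun z => by
      simp only [map_smul, LinearMap.smul_apply, hN, smul_lie, lie_smul, smul_eq_mul]; ring)
  have hnabla : ∀ x y z, B (nabla x y) z = 1 / 2 * (B ⁅x, y⁆ z - B ⁅y, z⁆ x + B ⁅z, x⁆ y) := hN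
  refine ⟨nabla, ⟨fun x y => key _ _ fun z => ?_, fun x y z => ?_⟩, fun nabla' h' => ?_⟩
  · rw [map_sub, LinearMap.sub_apply, hnabla, hnabla]
    rw [← lie_skew y x, ← lie_skew z x, ← lie_skew z y]
    simp only [map_neg, LinearMap.neg_apply]
    ring
  · rw [hB.symm y, hnabla, hnabla]
    rw [← lie_skew z y, ← lie_skew z x, ← lie_skew y x]
    simp only [map_neg, LinearMap.neg_apply]
    ring
  · refine LinearMap.ext fun x => LinearMap.ext fun y => key _ _ fun z => ?_
    rw [h'.koszul hB, hnabla]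

/-- The metric `B` is flat: the curvature `R(x,y) = [∇_x, ∇_y] - ∇_[x,y]` of its Levi-Civita
connection vanishes. -/
def IsFlat (B : LinearMap.BilinForm ℝ g) : Prop :=
  ∃ nabla : g →ₗ[ℝ] g →ₗ[ℝ] g, IsLeviCivita B nabla ∧
    ∀ x y z, nabla x (nabla y z) - nabla y (nabla x z) - nabla ⁅x, y⁆ z = 0

/-- The 1-form `θ` is parallel, `∇θ = 0`, where `(∇_x θ)(y) = -θ(∇_x y)` for left-invariant
objects. -/
def IsParallel (B : LinearMap.BilinForm ℝ g) (θ : Module.Dual ℝ g) : Prop :=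
  ∃ nabla : g →ₗ[ℝ] g →ₗ[ℝ] g, IsLeviCivita B nabla ∧ ∀ x y, -θ (nabla x y) = 0

/-- Chevalley-Eilenberg differential of a 1-form (trivial coefficients). -/
def d₁ (θ : Module.Dual ℝ g) (x y : g) : ℝ := -θ ⁅x, y⁆

/-- Chevalley-Eilenberg differential of a 2-form (trivial coefficients). -/
def d₂ (β : LinearMap.BilinForm ℝ g) (x y z : g) : ℝ :=
  -β ⁅x, y⁆ z - β ⁅y, z⁆ x - β ⁅z, x⁆ y

/-- The wedge product `θ ∧ β` of a 1-form and a 2-form. -/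
def wedge (θ : Module.Dual ℝ g) (β : LinearMap.BilinForm ℝ g) (x y z : g) : ℝ :=
  θ x * β y z + θ y * β z x + θ z * β x y

/-- `(J, B)` is a Hermitian structure: `J` is an integrable complex structure (`J² = -1` and
`N_J = 0`) and `B` is a `J`-invariant inner product. -/
structure IsHermitian (J : g →ₗ[ℝ] g) (B : LinearMap.BilinForm ℝ g) : Prop where
  sq : ∀ x, J (J x) = -x
  integrable : ∀ x y, ⁅J x, J y⁆ - ⁅x, y⁆ - J (⁅J x, y⁆ + ⁅x, J y⁆) = 0
  inner : IsInnerProduct B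
  compat : ∀ x y, B (J x) (J y) = B x y

/-- The fundamental form `ω(x, y) = ⟨J x, y⟩`. -/
def fundamentalForm (J : g →ₗ[ℝ] g) (B : LinearMap.BilinForm ℝ g) : LinearMap.BilinForm ℝ g :=
  B ∘ₗ J

/-- `(J, B)` is locally conformally Kähler with Lee form `θ`. -/
structure IsLCK (J : g →ₗ[ℝ] g) (B : LinearMap.BilinForm ℝ g) (θ : Module.Dual ℝ g) : Prop where
  hermitian : IsHermitian J B
  lee_closed : ∀ x y, d₁ θ x y = 0
  lck : ∀ x y z, d₂ (fundamentalForm J B) x y z = wedge θ (fundamentalForm J B) x y z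

/-- `(J, B)` is a Vaisman structure with Lee form `θ`. -/
structure IsVaisman (J : g →ₗ[ℝ] g) (B : LinearMap.BilinForm ℝ g) (θ : Module.Dual ℝ g) : Prop
    extends IsLCK J B θ where
  parallel : IsParallel B θ

/-- `(J, B)` is a Kähler structure. -/
structure IsKahler (J : g →ₗ[ℝ] g) (B : LinearMap.BilinForm ℝ g) : Prop where
  hermitian : IsHermitian J B
  closed : ∀ x y z, d₂ (fundamentalForm J B) x y z = 0

/-- `(g, J, B)` is a Kähler flat Lie algebra. -/
structure IsKahlerFlat (J : g →ₗ[ℝ] g) (B : LinearMap.BilinForm ℝ g) : Prop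
    extends IsKahler J B where
  flat : IsFlat B

/-- The kernel of a closed 1-form, as an ideal. -/
def kerForm (θ : Module.Dual ℝ g) (hθ : ∀ x y, d₁ θ x y = 0) : LieIdeal ℝ g where
  toSubmodule := LinearMap.ker θ
  lie_mem {x m} _ := neg_eq_zero.1 (hθ x m)

end Metric

/-- A closed 2-form on a real Lie algebra. -/
structure ClosedTwoForm (k : Type u) [LieRing k] [LieAlgebra ℝ k] where
  form : LinearMap.BilinForm ℝ k
  alt : ∀ x, form x x = 0
  closed : ∀ x y z, d₂ form x y z = 0

/-- The fundamental 2-form of a Kähler Lie algebra. -/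
def IsKahler.form {k : Type u} [LieRing k] [LieAlgebra ℝ k] {J : k →ₗ[ℝ] k}
    {B : LinearMap.BilinForm ℝ k} (h : IsKahler J B) : ClosedTwoForm k where
  form := fundamentalForm J B
  alt x := by
    have e := h.hermitian.compat x (J x)
    rw [h.hermitian.sq, map_neg, h.hermitian.inner.symm x] at e
    change B (J x) x = 0
    linarith
  closed := h.closed

/-- The underlying space `ℝ ξ ⊕ k` of the central extension of `k` by `β`. -/
@[ext] structure CentralExtension {k : Type u} [LieRing k] [LieAlgebra ℝ k]
    (β : ClosedTwoForm k) where
  /-- the coefficient of `ξ` -/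
  coeff : ℝ
  /-- the component in `k` -/
  base : k

namespace CentralExtension

variable {k : Type u} [LieRing k] [LieAlgebra ℝ k] (β : ClosedTwoForm k)

def equivProd : CentralExtension β ≃ ℝ × k where
  toFun z := (z.coeff, z.base)
  invFun p := ⟨p.1, p.2⟩
  left_inv _ := rfl
  right_inv _ := rfl

instance : AddCommGroup (CentralExtension β) := (equivProd β).addCommGroup

instance : Module ℝ (CentralExtension β) := (equivProd β).module ℝ

/-- `[a ξ + x, b ξ + y] = β(x, y) ξ + [x, y]`. -/
instance : Bracket (CentralExtension β) (CentralExtension β) where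
  bracket z w := ⟨β.form z.base w.base, ⁅z.base, w.base⁆⟩

@[simp] theorem zero_coeff : (0 : CentralExtension β).coeff = 0 := rfl
@[simp] theorem zero_base : (0 : CentralExtension β).base = 0 := rfl
@[simp] theorem add_coeff (z w : CentralExtension β) : (z + w).coeff = z.coeff + w.coeff := rfl
@[simp] theorem add_base (z w : CentralExtension β) : (z + w).base = z.base + w.base := rfl
@[simp] theorem smul_coeff (c : ℝ) (z : CentralExtension β) : (c • z).coeff = c * z.coeff := rfl
@[simp] theorem smul_base (c : ℝ) (z : CentralExtension β) : (c • z).base = c • z.base := rfl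
@[simp] theorem lie_coeff (z w : CentralExtension β) :
    ⁅z, w⁆.coeff = β.form z.base w.base := rfl
@[simp] theorem lie_base (z w : CentralExtension β) : ⁅z, w⁆.base = ⁅z.base, w.base⁆ := rfl

theorem form_skew (x y : k) : β.form x y = -β.form y x := by
  have h := β.alt (x + y)
  simp only [map_add, LinearMap.add_apply, β.alt] at h
  linarith

instance : LieRing (CentralExtension β) where
  add_lie z w v := by ext <;> simp
  lie_add z w v := by ext <;> simp
  lie_self z := by ext <;> simp [β.alt]
  leibniz_lie z w v := by
    ext
    · have h := β.closed z.base w.base v.base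
      simp only [d₂] at h
      simp only [add_coeff, lie_coeff, lie_base]
      rw [form_skew β z.base, form_skew β w.base, ← lie_skew v.base z.base] at *
      simp only [map_neg, LinearMap.neg_apply] at h
      linarith
    · simp

instance : LieAlgebra ℝ (CentralExtension β) where
  lie_smul c z w := by ext <;> simp

/-- The central generator `ξ`. -/
def gen : CentralExtension β := ⟨1, 0⟩

/-- The inclusion of the vector space `k` (not a Lie algebra homomorphism in general). -/
def incl : k →ₗ[ℝ] CentralExtension β where
  toFun x := ⟨0, x⟩
  map_add' x y := by ext <;> simp
  map_smul' c x := by ext <;> simp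

end CentralExtension

section DoubleExtension

-- `ℝ` with the commutator bracket is the 1-dimensional abelian Lie algebra.
attribute [local instance] LieRing.ofAssociativeRing LieAlgebra.ofAssociativeAlgebra

variable {k : Type u} [LieRing k] [LieAlgebra ℝ k] {β : ClosedTwoForm k}

/-- The homomorphism `t ↦ t D` from the abelian Lie algebra `ℝ` into the derivations. -/
def lineAction (D : LieDerivation ℝ (CentralExtension β) (CentralExtension β)) :
    ℝ →ₗ⁅ℝ⁆ LieDerivation ℝ (CentralExtension β) (CentralExtension β) where
  toLinearMap := LinearMap.toSpanSingleton ℝ _ D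
  map_lie' {s t} := by
    simp [LieRing.of_associative_ring_bracket, mul_comm]

/-- The double extension `k(D, β) = ℝ ⋉_D k_β(ξ)`. -/
def DoubleExtension (D : LieDerivation ℝ (CentralExtension β) (CentralExtension β)) : Type u :=
  LieAlgebra.SemiDirectSum (CentralExtension β) ℝ (lineAction D)

namespace DoubleExtension

variable (D : LieDerivation ℝ (CentralExtension β) (CentralExtension β))

instance : LieRing (DoubleExtension D) :=
  inferInstanceAs (LieRing (LieAlgebra.SemiDirectSum (CentralExtension β) ℝ (lineAction D)))

instance : LieAlgebra ℝ (DoubleExtension D) :=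
  inferInstanceAs (LieAlgebra ℝ (LieAlgebra.SemiDirectSum (CentralExtension β) ℝ (lineAction D)))

/-- The generator of the factor `ℝ`. -/
def gen : DoubleExtension D := LieAlgebra.SemiDirectSum.inr (lineAction D) 1

/-- The inclusion of the ideal `k_β(ξ)`. -/
def incl : CentralExtension β →ₗ⁅ℝ⁆ DoubleExtension D :=
  LieAlgebra.SemiDirectSum.inl (lineAction D)

end DoubleExtension

end DoubleExtension

end VaismanLie

namespace VaismanLie

/-! ### Consequences of Lie's theorem for the derived algebra. -/

section Solvable

open Module LieModule

/-! The theorem rests on two facts: `J A` is central, and the transverse Kähler algebra is flat.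

Centrality. Parallelism of `θ` makes `ad A` skew, and the Vaisman equations then give that `ad A`
commutes with `J`, that `ad (J A)` is skew, and that `⟨J A, [x, y]⟩` is the transverse part of `ω`
(`IsVaisman.inner_J_lie`). If `J A` lies in the derived algebra, solvability gives `tr (ad (J A))² =
0`, so the skew map `ad (J A)` vanishes. Otherwise a functional that kills brackets but not `J A`
yields a vector `w` whose adjoint action expands the transverse form at unit rate. Unimodularity
forbids this unless the transverse space is zero, and then `A` and `J A`, which commute, span
everything (`IsVaisman.J_lie_eq_zero`).

Flatness. Projecting brackets orthogonally to `A` and `J A` gives a Lie bracket on the complement,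
because `J A` is central and brackets have no `A` component. This algebra is Kähler, unimodular and
solvable. For unimodular Kähler algebras the scalar curvature is a trace of the Ricci form and
vanishes (`IsKahler.sum_curvature`). Written in structure constants, and with the Killing form zero
on squares from the derived algebra, its vanishing says that a sum of squares is zero
(`structureConstants_eq_zero`). So the derived algebra and its complement are both abelian and the
complement acts skewly, which forces flatness.

The component of a bracket along `J A` is `ω'`, which yields the central extension; adjoining `A`
through `ad A` yields the double extension. -/

theorem exists_ne_zero_forall_lie_lie_eq_zero (K L V : Type*) [Field K] [IsAlgClosed K] [CharZero K]
    [LieRing L] [LieAlgebra K L] [LieAlgebra.IsSolvable L]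
    [AddCommGroup V] [Module K V] [FiniteDimensional K V] [Nontrivial V]
    [LieRingModule L V] [LieModule K L V] :
    ∃ N : LieSubmodule K L V, N ≠ ⊥ ∧ ∀ x y : L, ∀ v ∈ N, ⁅⁅x, y⁆, v⁆ = 0 := by
  -- Lie's theorem gives a common eigenvector; scalars commute, so brackets annihilate the line it
  -- spans.
  obtain ⟨χ, hχ⟩ := exists_nontrivial_weightSpace_of_isSolvable K L V
  obtain ⟨⟨v, hv⟩, hv0⟩ := exists_ne (0 : weightSpace V χ)
  rw [mem_weightSpace] at hv
  have hv0' : v ≠ 0 := fun h => hv0 (Subtype.ext h)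
  let N : LieSubmodule K L V :=
    { toSubmodule := K ∙ v
      lie_mem := by
        intro x m hm
        obtain ⟨c, rfl⟩ := Submodule.mem_span_singleton.1 hm
        rw [lie_smul, hv]
        exact Submodule.smul_mem _ _
          (Submodule.smul_mem _ _ (Submodule.mem_span_singleton_self v)) }
  refine ⟨N, ?_, ?_⟩
  · intro h
    have : v ∈ N := Submodule.mem_span_singleton_self v
    rw [h] at this
    exact hv0' this
  · intro x y m hm
    obtain ⟨c, rfl⟩ := Submodule.mem_span_singleton.1 (show m ∈ K ∙ v from hm)
    rw [lie_smul, lie_lie, hv x, hv y, lie_smul, lie_smul, hv x, hv y, smul_comm, sub_self,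
      smul_zero]

/-- Over an algebraically closed field of characteristic zero, the derived algebra of a solvable
Lie algebra acts by nilpotent endomorphisms. -/
theorem isNilpotent_toEnd_of_mem_span_lie (K L : Type*) [Field K] [IsAlgClosed K] [CharZero K]
    [LieRing L] [LieAlgebra K L] [LieAlgebra.IsSolvable L]
    {z : L} (hz : z ∈ Submodule.span K {m : L | ∃ x y : L, ⁅x, y⁆ = m})
    (V : Type*) [AddCommGroup V] [Module K V] [FiniteDimensional K V]
    [LieRingModule L V] [LieModule K L V] :
    IsNilpotent (toEnd K L V z) := by
  induction hn : finrank K V using Nat.strong_induction_on generalizing V with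
  | _ n ih =>
  rcases subsingleton_or_nontrivial V with hV | hV
  · exact ⟨1, LinearMap.ext fun v => Subsingleton.elim _ _⟩
  obtain ⟨N, hN, hN0⟩ := exists_ne_zero_forall_lie_lie_eq_zero K L V
  have hzN : ∀ v ∈ N, ⁅z, v⁆ = 0 := by
    intro v hv
    clear ih
    induction hz using Submodule.span_induction with
    | mem m hm => obtain ⟨x, y, rfl⟩ := hm; exact hN0 x y v hv
    | zero => exact zero_lie v
    | add a b _ _ ha hb => rw [add_lie, ha, hb, add_zero]
    | smul c a _ ha => rw [smul_lie, ha, smul_zero]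
  -- Induction on dimension: if `z ^ k` is zero on `V ⧸ N`, then `z ^ k` maps `V` into `N`, where
  -- `z` acts as zero.
  have hlt : finrank K (V ⧸ N) < n := by
    have h1 := Submodule.finrank_quotient_add_finrank N.toSubmodule
    have h2 : 0 < finrank K N.toSubmodule := by
      rw [finrank_pos_iff, Submodule.nontrivial_iff_ne_bot]
      simpa using hN
    have h3 : finrank K (V ⧸ N) = finrank K (V ⧸ N.toSubmodule) := rfl
    omega
  have : FiniteDimensional K (V ⧸ N) :=
    inferInstanceAs (FiniteDimensional K (V ⧸ N.toSubmodule))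
  obtain ⟨k, hk⟩ := ih _ hlt (V ⧸ N) rfl
  have hmk : ∀ (j : ℕ) (v : V), LieSubmodule.Quotient.mk' N ((toEnd K L V z ^ j) v) =
      (toEnd K L (V ⧸ N) z ^ j) (LieSubmodule.Quotient.mk' N v) := by
    intro j v
    induction j with
    | zero => simp
    | succ j hj => rw [pow_succ', pow_succ', Module.End.mul_apply, Module.End.mul_apply, ← hj,
        toEnd_apply_apply, toEnd_apply_apply, LieModuleHom.map_lie]
  refine ⟨k + 1, LinearMap.ext fun v => ?_⟩
  rw [pow_succ', Module.End.mul_apply, toEnd_apply_apply, LinearMap.zero_apply]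
  refine hzN _ ?_
  rw [← LieSubmodule.Quotient.mk_eq_zero, hmk, hk, LinearMap.zero_apply]

open TensorProduct in
/-- The Killing form of a solvable real Lie algebra vanishes on squares of elements of the derived
algebra. -/
theorem trace_ad_comp_ad_eq_zero_of_mem_span_lie {L : Type*} [LieRing L] [LieAlgebra ℝ L]
    [FiniteDimensional ℝ L] [LieAlgebra.IsSolvable L]
    {z : L} (hz : z ∈ Submodule.span ℝ {m : L | ∃ x y : L, ⁅x, y⁆ = m}) :
    LinearMap.trace ℝ L (LieAlgebra.ad ℝ L z ∘ₗ LieAlgebra.ad ℝ L z) = 0 := by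
  -- Lie's theorem needs an algebraically closed field, so the trace is computed after
  -- complexification.
  have hz' : (1 : ℂ) ⊗ₜ[ℝ] z ∈
      Submodule.span ℂ {m : ℂ ⊗[ℝ] L | ∃ x y : ℂ ⊗[ℝ] L, ⁅x, y⁆ = m} := by
    induction hz using Submodule.span_induction with
    | mem m hm =>
      obtain ⟨x, y, rfl⟩ := hm
      exact Submodule.subset_span ⟨1 ⊗ₜ x, 1 ⊗ₜ y, by simp⟩
    | zero => simp
    | add a b _ _ ha hb => rw [TensorProduct.tmul_add]; exact add_mem ha hb
    | smul c a _ ha =>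
      rw [← TensorProduct.smul_tmul, Algebra.smul_def, mul_one, ← mul_one (algebraMap ℝ ℂ c),
        ← smul_eq_mul, ← TensorProduct.smul_tmul']
      exact Submodule.smul_mem _ _ ha
  have hnil := isNilpotent_toEnd_of_mem_span_lie ℂ (ℂ ⊗[ℝ] L) hz' (ℂ ⊗[ℝ] L)
  rw [toEnd_baseChange] at hnil
  apply (algebraMap ℝ ℂ).injective
  rw [← LinearMap.trace_baseChange, LinearMap.baseChange_comp, map_zero]
  exact (LinearMap.isNilpotent_trace_of_isNilpotent
    (Commute.isNilpotent_mul_right (Commute.refl _) hnil)).eq_zero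

end Solvable

/-! ### Orthonormal bases of a positive definite bilinear form. -/

section Orthonormal

open Module

variable {V : Type*} [AddCommGroup V] [Module ℝ V]

/-- A family of vectors is orthonormal for the bilinear form `B`. -/
def IsOrthonormal {ι : Type*} [DecidableEq ι] (B : LinearMap.BilinForm ℝ V) (e : ι → V) : Prop :=
  ∀ i j, B (e i) (e j) = if i = j then 1 else 0

theorem exists_orthonormal_basis [FiniteDimensional ℝ V] {B : LinearMap.BilinForm ℝ V}
    (hs : ∀ x y, B x y = B y x) (hp : ∀ x, x ≠ 0 → 0 < B x x) :
    ∃ e : Basis (Fin (finrank ℝ V)) ℝ V, IsOrthonormal B e := by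
  obtain ⟨v, hv⟩ := LinearMap.BilinForm.exists_orthogonal_basis (B := B) ⟨hs⟩
  have hpos : ∀ i, 0 < B (v i) (v i) := fun i => hp _ (v.ne_zero i)
  have hsq : ∀ i, 0 < √(B (v i) (v i)) := fun i => Real.sqrt_pos.2 (hpos i)
  refine ⟨v.isUnitSMul (w := fun i => (√(B (v i) (v i)))⁻¹)
    fun i => (inv_ne_zero (hsq i).ne').isUnit, fun i j => ?_⟩
  simp only [Basis.isUnitSMul_apply, map_smul, LinearMap.smul_apply, smul_eq_mul]
  split_ifs with h
  · subst h
    have h1 := Real.mul_self_sqrt (hpos i).le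
    have h2 := (hsq i).ne'
    field_simp
    rw [pow_two, h1]
  · have : B (v i) (v j) = 0 := hv h
    rw [this, mul_zero, mul_zero]

/-- An orthonormal basis adapted to a subspace and its orthogonal complement. -/
theorem exists_adapted_orthonormal_basis [FiniteDimensional ℝ V] {B : LinearMap.BilinForm ℝ V}
    (hs : ∀ x y, B x y = B y x) (hp : ∀ x, x ≠ 0 → 0 < B x x) (W : Submodule ℝ V) :
    ∃ (a b : ℕ) (e : Basis (Fin a ⊕ Fin b) ℝ V), IsOrthonormal B e ∧
      (∀ i, e (Sum.inl i) ∈ W) ∧ ∀ i, ∀ w ∈ W, B w (e (Sum.inr i)) = 0 := by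
  have hcompl : IsCompl W (B.orthogonal W) := by
    rw [LinearMap.BilinForm.isCompl_orthogonal_iff_disjoint
      (fun x y h => by rw [hs y x]; exact h), Submodule.disjoint_def]
    intro x hx hx'
    by_contra h
    exact (hp x h).ne' (hx' x hx)
  obtain ⟨v, hv⟩ := exists_orthonormal_basis (V := W) (B := B.restrict W)
    (fun x y => hs x y) (fun x hx => hp x (by simpa using hx))
  obtain ⟨w, hw⟩ := exists_orthonormal_basis (V := B.orthogonal W)
    (B := B.restrict (B.orthogonal W)) (fun x y => hs x y) (fun x hx => hp x (by simpa using hx))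
  let e := (v.prod w).map (Submodule.prodEquivOfIsCompl W (B.orthogonal W) hcompl)
  have he1 : ∀ i, e (Sum.inl i) = v i := fun i => by simp [e]
  have he2 : ∀ i, e (Sum.inr i) = w i := fun i => by simp [e]
  have horth : ∀ i, ∀ x ∈ W, B x (w i) = 0 := fun i x hx => (w i).2 x hx
  refine ⟨_, _, e, ?_, fun i => ?_, fun i x hx => ?_⟩
  · rintro (i | i) (j | j)
    · rw [he1, he1]; simpa using hv i j
    · rw [he1, he2]; simpa using horth j _ (v i).2
    · rw [he1, he2, hs]; simpa using horth i _ (v j).2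
    · rw [he2, he2]; simpa using hw i j
  · rw [he1]; exact (v i).2
  · rw [he2]; exact horth i x hx

variable {ι : Type*} [Fintype ι] [DecidableEq ι] {B : LinearMap.BilinForm ℝ V} {e : Basis ι ℝ V}

theorem IsOrthonormal.repr_eq (he : IsOrthonormal B e) (x : V) (i : ι) :
    e.repr x i = B x (e i) := by
  conv_rhs => rw [← e.sum_repr x]
  simp only [map_sum, map_smul, LinearMap.sum_apply, LinearMap.smul_apply, he _ i, smul_eq_mul]
  simp

theorem IsOrthonormal.sum_smul (he : IsOrthonormal B e) (x : V) : ∑ i, B x (e i) • e i = x := by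
  simp only [← he.repr_eq, e.sum_repr]

theorem IsOrthonormal.sum_mul (he : IsOrthonormal B e) (hs : ∀ x y, B x y = B y x) (x y : V) :
    ∑ i, B x (e i) * B y (e i) = B x y := by
  conv_rhs => rw [← he.sum_smul x]
  simp only [map_sum, map_smul, LinearMap.sum_apply, LinearMap.smul_apply, smul_eq_mul, hs y]

theorem IsOrthonormal.trace_eq (he : IsOrthonormal B e) (f : V →ₗ[ℝ] V) :
    LinearMap.trace ℝ V f = ∑ i, B (f (e i)) (e i) := by
  rw [LinearMap.trace_eq_matrix_trace ℝ e, Matrix.trace]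
  simp [LinearMap.toMatrix_apply, he.repr_eq]

theorem IsOrthonormal.ext (he : IsOrthonormal B e) {x y : V} (h : ∀ i, B x (e i) = B y (e i)) :
    x = y := by
  rw [← he.sum_smul x, ← he.sum_smul y]
  simp only [h]

/-- The metric trace of a bilinear form is invariant under an orthogonal transformation. -/
theorem IsOrthonormal.sum_comp_isometry (he : IsOrthonormal B e) (hs : ∀ x y, B x y = B y x)
    {J J' : V →ₗ[ℝ] V} (hJ : ∀ x y, B (J x) y = B x (J' y)) (hJJ : ∀ x, J (J' x) = x)
    (b : LinearMap.BilinForm ℝ V) :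
    ∑ i, b (J (e i)) (J (e i)) = ∑ i, b (e i) (e i) := by
  -- The vectors `J (e i)` also resolve the identity, since `J'` is both the adjoint and a right
  -- inverse of `J`.
  have h1 : ∀ x y, ∑ i, B (J (e i)) x * b (J (e i)) y = b x y := by
    intro x y
    have : ∑ i, B (J (e i)) x • J (e i) = x := by
      simp only [hJ, hs _ (J' x), ← map_smul, ← map_sum, he.sum_smul, hJJ]
    conv_rhs => rw [← this]
    simp only [map_sum, map_smul, LinearMap.sum_apply, LinearMap.smul_apply, smul_eq_mul]
  have h2 : ∀ i, b (J (e i)) (J (e i)) = ∑ k, B (J (e i)) (e k) * b (J (e i)) (e k) := by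
    intro i
    conv_lhs => rw [← he.sum_smul (J (e i)), he.sum_smul (J (e i))]
    conv_lhs => enter [2]; rw [← he.sum_smul (J (e i))]
    simp only [map_sum, map_smul, smul_eq_mul]
  simp only [h2]
  rw [Finset.sum_comm]
  simp only [h1]

end Orthonormal

/-! ### Contractions of Christoffel symbols and structure constants. -/

section StructureConstants

variable {ι : Type*} [Fintype ι]

/-- Exchange the names `j` and `k` and use skewness once. Together with the next lemma this reduces
all mixed quadratic contractions to a single one. -/
theorem sum_mul_rotate_of_skew {Γ : ι → ι → ι → ℝ} (hΓ : ∀ i j k, Γ i j k = -Γ i k j) :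
    ∑ i, ∑ j, ∑ k, Γ i j k * Γ k i j = -∑ i, ∑ j, ∑ k, Γ i j k * Γ j i k := by
  rw [← Finset.sum_neg_distrib]
  refine Finset.sum_congr rfl fun i _ => ?_
  rw [Finset.sum_comm, ← Finset.sum_neg_distrib]
  refine Finset.sum_congr rfl fun j _ => ?_
  rw [← Finset.sum_neg_distrib]
  refine Finset.sum_congr rfl fun k _ => ?_
  rw [hΓ i k j]
  ring

theorem sum_mul_transpose_of_skew {Γ : ι → ι → ι → ℝ} (hΓ : ∀ i j k, Γ i j k = -Γ i k j) :
    ∑ i, ∑ j, ∑ k, Γ j i k * Γ k i j = ∑ i, ∑ j, ∑ k, Γ i j k * Γ j i k := by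
  have h := sum_mul_rotate_of_skew hΓ
  rw [← neg_eq_iff_eq_neg] at h
  rw [← h, Finset.sum_comm, ← Finset.sum_neg_distrib]
  refine Finset.sum_congr rfl fun i _ => ?_
  rw [← Finset.sum_neg_distrib]
  refine Finset.sum_congr rfl fun j _ => ?_
  rw [← Finset.sum_neg_distrib]
  refine Finset.sum_congr rfl fun k _ => ?_
  rw [hΓ k j i]
  ring

/-- With Christoffel symbols `Γ` and structure constants `c i j k = Γ i j k - Γ j i k`, the sum
`∑ c i j k ^ 2 + 2 ∑ c i j k * c i k j` is four times a contraction of `Γ ⊗ Γ`. -/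
theorem sum_sq_add_two_mul_sum_eq {Γ : ι → ι → ι → ℝ} (hΓ : ∀ i j k, Γ i j k = -Γ i k j) :
    (∑ i, ∑ j, ∑ k, (Γ i j k - Γ j i k) ^ 2) +
      2 * ∑ i, ∑ j, ∑ k, (Γ i j k - Γ j i k) * (Γ i k j - Γ k i j) =
    4 * ∑ i, ∑ j, ∑ k, Γ i j k * Γ j i k := by
  have h1 := sum_mul_rotate_of_skew hΓ
  have h2 := sum_mul_transpose_of_skew hΓ
  have h3 : ∑ i, ∑ j, ∑ k, Γ j i k ^ 2 = ∑ i, ∑ j, ∑ k, Γ i j k ^ 2 := Finset.sum_comm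
  have e1 : ∀ i j k, (Γ i j k - Γ j i k) ^ 2 =
      Γ i j k ^ 2 + Γ j i k ^ 2 - 2 * (Γ i j k * Γ j i k) := fun i j k => by ring
  have e2 : ∀ i j k, (Γ i j k - Γ j i k) * (Γ i k j - Γ k i j) =
      -Γ i j k ^ 2 - Γ i j k * Γ k i j + Γ i j k * Γ j i k + Γ j i k * Γ k i j :=
    fun i j k => by rw [hΓ i k j]; ring
  simp only [e1, e2, Finset.sum_add_distrib, Finset.sum_sub_distrib, ← Finset.mul_sum,
    Finset.sum_neg_distrib, h1, h2, h3]
  ring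

theorem eq_zero_of_sum_sq_eq_zero {ι₁ ι₂ ι₃ : Type*} [Fintype ι₁] [Fintype ι₂] [Fintype ι₃]
    (f : ι₁ → ι₂ → ι₃ → ℝ) (hf : ∑ i, ∑ j, ∑ k, f i j k ^ 2 = 0) (i : ι₁) (j : ι₂) (k : ι₃) :
    f i j k = 0 := by
  have h1 := (Fintype.sum_eq_zero_iff_of_nonneg (fun i => by positivity)).1 hf
  have h2 := (Fintype.sum_eq_zero_iff_of_nonneg (fun j => by positivity)).1 (congrFun h1 i)
  have h3 := (Fintype.sum_eq_zero_iff_of_nonneg (fun k => by positivity)).1 (congrFun h2 j)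
  exact pow_eq_zero_iff two_ne_zero |>.1 (congrFun h3 k)

variable {α β : Type*} [Fintype α] [Fintype β]

/-- Left indices label the derived algebra, right indices its complement. The Killing terms with
left first index drop out. The surviving Killing terms combine with the mixed squares, each counted
twice by skewness, into the squares of the symmetric parts of the complement's action. Hence `hT` is
a sum of nonnegative terms. -/
theorem structureConstants_eq_zero {c : α ⊕ β → α ⊕ β → α ⊕ β → ℝ}
    (hskew : ∀ i j k, c i j k = -c j i k) (hder : ∀ i j k, c i j (Sum.inr k) = 0)
    (hkill : ∀ i, ∑ j, ∑ k, c (Sum.inl i) j k * c (Sum.inl i) k j = 0)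
    (hT : (∑ i, ∑ j, ∑ k, c i j k ^ 2) + 2 * ∑ i, ∑ j, ∑ k, c i j k * c i k j = 0) :
    (∀ i j k, c (Sum.inl i) (Sum.inl j) (Sum.inl k) = 0) ∧
    (∀ i j k, c (Sum.inr i) (Sum.inr j) (Sum.inl k) = 0) ∧
    ∀ i j k, c (Sum.inr i) (Sum.inl j) (Sum.inl k) + c (Sum.inr i) (Sum.inl k) (Sum.inl j) = 0 := by
  set X := ∑ i : α, ∑ j : α, ∑ k : α, c (Sum.inl i) (Sum.inl j) (Sum.inl k) ^ 2 with hX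
  set Y := ∑ i : β, ∑ j : β, ∑ k : α, c (Sum.inr i) (Sum.inr j) (Sum.inl k) ^ 2 with hY
  set Z := ∑ i : β, ∑ j : α, ∑ k : α,
    (c (Sum.inr i) (Sum.inl j) (Sum.inl k) + c (Sum.inr i) (Sum.inl k) (Sum.inl j)) ^ 2 with hZ
  have hsum : X + Y + Z = 0 := by
    have hmix : ∑ i : α, ∑ j : β, ∑ k : α, c (Sum.inl i) (Sum.inr j) (Sum.inl k) ^ 2 =
        ∑ i : β, ∑ j : α, ∑ k : α, c (Sum.inr i) (Sum.inl j) (Sum.inl k) ^ 2 := by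
      rw [Finset.sum_comm]
      refine Finset.sum_congr rfl fun i _ => Finset.sum_congr rfl fun j _ =>
        Finset.sum_congr rfl fun k _ => ?_
      rw [hskew, neg_sq]
    have htr : ∑ i : β, ∑ j : α, ∑ k : α, c (Sum.inr i) (Sum.inl k) (Sum.inl j) ^ 2 =
        ∑ i : β, ∑ j : α, ∑ k : α, c (Sum.inr i) (Sum.inl j) (Sum.inl k) ^ 2 :=
      Finset.sum_congr rfl fun i _ => Finset.sum_comm
    have hexp : ∀ a b : ℝ, (a + b) ^ 2 = a ^ 2 + b ^ 2 + 2 * (a * b) := fun a b => by ring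
    have hZ' : Z = 2 * (∑ i : β, ∑ j : α, ∑ k : α, c (Sum.inr i) (Sum.inl j) (Sum.inl k) ^ 2) +
        2 * ∑ i : β, ∑ j : α, ∑ k : α,
          c (Sum.inr i) (Sum.inl j) (Sum.inl k) * c (Sum.inr i) (Sum.inl k) (Sum.inl j) := by
      rw [hZ]
      simp only [hexp, Finset.sum_add_distrib, ← Finset.mul_sum, htr]
      ring
    rw [Fintype.sum_sum_type (f := fun i => ∑ j, ∑ k, c i j k * c i k j)] at hT
    simp only [hkill] at hT
    simp only [Fintype.sum_sum_type, hder, Finset.sum_add_distrib, Finset.sum_const_zero, add_zero,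
      zero_mul, mul_zero, ne_eq, OfNat.ofNat_ne_zero, not_false_eq_true, zero_pow, zero_add,
      hmix] at hT
    rw [hZ']
    linarith
  have hX0 : 0 ≤ X := by positivity
  have hY0 : 0 ≤ Y := by positivity
  have hZ0 : 0 ≤ Z := by positivity
  exact ⟨eq_zero_of_sum_sq_eq_zero _ (by linarith : X = 0),
    eq_zero_of_sum_sq_eq_zero _ (by linarith : Y = 0),
    eq_zero_of_sum_sq_eq_zero (fun i j k => c (Sum.inr i) (Sum.inl j) (Sum.inl k) +
      c (Sum.inr i) (Sum.inl k) (Sum.inl j)) (by linarith : Z = 0)⟩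

end StructureConstants

/-! ### Unimodular solvable Kähler Lie algebras are flat. -/

section KahlerFlat

open Module

variable {g : Type u} [LieRing g] [LieAlgebra ℝ g] {J : g →ₗ[ℝ] g} {B : LinearMap.BilinForm ℝ g}

theorem IsHermitian.skew (h : IsHermitian J B) (x y : g) : B (J x) y = -B x (J y) := by
  have e := h.compat x (J y)
  rw [h.sq, map_neg] at e
  linarith

theorem IsHermitian.skew' (h : IsHermitian J B) (x y : g) : B (J x) y = B x ((-J) y) := by
  rw [h.skew, LinearMap.neg_apply, map_neg]

theorem IsHermitian.sum_comp (h : IsHermitian J B) {ι : Type*} [Fintype ι] [DecidableEq ι]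
    {e : Basis ι ℝ g} (he : IsOrthonormal B e) (b : LinearMap.BilinForm ℝ g) :
    ∑ i, b (J (e i)) (J (e i)) = ∑ i, b (e i) (e i) :=
  he.sum_comp_isometry h.inner.symm h.skew'
    (fun x => by rw [LinearMap.neg_apply, map_neg, h.sq, neg_neg]) b

theorem IsInnerProduct.eq_of_forall (hB : IsInnerProduct B) {x y : g} (h : ∀ z, B x z = B y z) :
    x = y := by
  by_contra hne
  refine (hB.pos (x - y) (sub_ne_zero.2 hne)).ne' ?_
  rw [map_sub B, LinearMap.sub_apply, h, sub_self]

/-- The complex structure of a Kähler Lie algebra is parallel. -/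
theorem IsKahler.nabla_J (h : IsKahler J B) {nabla : g →ₗ[ℝ] g →ₗ[ℝ] g}
    (hn : IsLeviCivita B nabla) (x y : g) : nabla x (J y) = J (nabla x y) := by
  have hH := h.hermitian
  refine hH.inner.eq_of_forall fun z => ?_
  have k1 := hn.koszul hH.inner x (J y) z
  have k2 := hn.koszul hH.inner x y (J z)
  -- The classical identity expressing `∇J` through `dω` and the Nijenhuis tensor: two values of
  -- `dω` and one of `N_J`, paired with `J x`.
  have d1 := h.closed x y z
  have d2 := h.closed x (J y) (J z)
  have n1 := congrArg (fun v => B v (J x)) (hH.integrable y z)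
  simp only [d₂, fundamentalForm, LinearMap.comp_apply, hH.skew, hH.sq, map_neg, neg_neg] at d1 d2
  simp only [map_sub, map_add, LinearMap.sub_apply, LinearMap.add_apply, map_zero,
    LinearMap.zero_apply, hH.compat] at n1
  rw [hH.skew]
  linarith

variable {ι : Type*} [Fintype ι] [DecidableEq ι] {e : Basis ι ℝ g}

/-- Closedness of `ω` at `(x, e i, J (e i))` turns the pairing of the sum with `J x` into `2 tr (ad
x)`. -/
theorem IsKahler.sum_lie_J [FiniteDimensional ℝ g] (h : IsKahler J B)
    (hu : IsUnimodular g) (he : IsOrthonormal B e) :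
    ∑ i, ⁅e i, J (e i)⁆ = 0 := by
  have hH := h.hermitian
  refine hH.inner.eq_of_forall fun z => ?_
  obtain ⟨x, rfl⟩ : ∃ x, J x = z := ⟨-J z, by rw [map_neg, hH.sq, neg_neg]⟩
  have h1 : ∀ i, B ⁅e i, J (e i)⁆ (J x) =
      B ⁅x, e i⁆ (e i) + B ⁅x, J (e i)⁆ (J (e i)) := by
    intro i
    have d := h.closed x (e i) (J (e i))
    simp only [d₂, fundamentalForm, LinearMap.comp_apply, hH.skew, hH.sq, map_neg, neg_neg] at d
    rw [← lie_skew (J (e i)) x, map_neg, LinearMap.neg_apply] at d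
    linarith
  have h2 := hH.sum_comp he (B ∘ₗ LieAlgebra.ad ℝ g x)
  have h3 := hu x
  rw [he.trace_eq] at h3
  simp only [LinearMap.comp_apply, LieAlgebra.ad_apply] at h2 h3
  simp only [map_sum, LinearMap.sum_apply, h1, Finset.sum_add_distrib, h2, h3, map_zero,
    LinearMap.zero_apply, add_zero]

theorem IsLeviCivita.sum_nabla_self {nabla : g →ₗ[ℝ] g →ₗ[ℝ] g} (hB : IsInnerProduct B)
    (hn : IsLeviCivita B nabla) (hu : IsUnimodular g) (he : IsOrthonormal B e) :
    ∑ i, nabla (e i) (e i) = 0 := by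
  refine hB.eq_of_forall fun x => ?_
  have h1 : ∀ i, B (nabla (e i) (e i)) x = B ⁅x, e i⁆ (e i) := by
    intro i
    have m1 := hn.metric (e i) (e i) x
    have m2 := hn.metric x (e i) (e i)
    rw [hB.symm (e i)] at m1 m2
    rw [← hn.torsion_free x (e i), map_sub, LinearMap.sub_apply]
    linarith
  have h3 := hu x
  rw [he.trace_eq] at h3
  simp only [LieAlgebra.ad_apply] at h3
  simp only [map_sum, LinearMap.sum_apply, h1, h3, map_zero, LinearMap.zero_apply]

/-- The curvature tensor of a connection. -/
def curvature (nabla : g →ₗ[ℝ] g →ₗ[ℝ] g) (x y z : g) : g :=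
  nabla x (nabla y z) - nabla y (nabla x z) - nabla ⁅x, y⁆ z

theorem IsLeviCivita.bianchi {nabla : g →ₗ[ℝ] g →ₗ[ℝ] g} (hn : IsLeviCivita B nabla) (x y z : g) :
    curvature nabla x y z + curvature nabla y z x + curvature nabla z x y = 0 := by
  have h1 := hn.torsion_free x ⁅y, z⁆
  have h2 := hn.torsion_free y ⁅z, x⁆
  have h3 := hn.torsion_free z ⁅x, y⁆
  have j := lie_jacobi x y z
  rw [← h1, ← h2, ← h3] at j
  have e1 : nabla x ⁅y, z⁆ = nabla x (nabla y z) - nabla x (nabla z y) := by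
    rw [← hn.torsion_free, map_sub]
  have e2 : nabla y ⁅z, x⁆ = nabla y (nabla z x) - nabla y (nabla x z) := by
    rw [← hn.torsion_free, map_sub]
  have e3 : nabla z ⁅x, y⁆ = nabla z (nabla x y) - nabla z (nabla y x) := by
    rw [← hn.torsion_free, map_sub]
  rw [e1, e2, e3] at j
  rw [← j]
  simp only [curvature]
  abel

/-- A trace of the Ricci form. The commutator `[∇_x, ∇_y]` contributes nothing to the trace against
`J`, because `J` commutes with both factors; the rest is `∇` along `∑ [e i, J (e i)] = 0`. -/
theorem IsKahler.sum_curvature_J [FiniteDimensional ℝ g] (h : IsKahler J B)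
    {nabla : g →ₗ[ℝ] g →ₗ[ℝ] g}
    (hn : IsLeviCivita B nabla) (hu : IsUnimodular g) (he : IsOrthonormal B e) :
    ∑ i, ∑ j, B (curvature nabla (e i) (J (e i)) (e j)) (J (e j)) = 0 := by
  have hH := h.hermitian
  have hcomm : ∀ x, nabla x ∘ₗ J = J ∘ₗ nabla x := fun x => LinearMap.ext fun y => h.nabla_J hn x y
  have htr : ∀ x y, ∑ j, B (nabla x (nabla y (e j))) (J (e j)) =
      ∑ j, B (nabla y (nabla x (e j))) (J (e j)) := by
    intro x y
    have h1 : ∀ x y, ∑ j, B (nabla x (nabla y (e j))) (J (e j)) =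
        -LinearMap.trace ℝ g (J ∘ₗ nabla x ∘ₗ nabla y) := by
      intro x y
      rw [he.trace_eq, ← Finset.sum_neg_distrib]
      refine Finset.sum_congr rfl fun j _ => ?_
      rw [LinearMap.comp_apply, hH.skew, neg_neg, LinearMap.comp_apply]
    rw [h1, h1, ← LinearMap.comp_assoc, LinearMap.trace_comp_comm', ← hcomm,
      ← LinearMap.comp_assoc, LinearMap.trace_comp_comm' _ (nabla y ∘ₗ nabla x)]
  have hlie : ∑ i, ∑ j, B (nabla ⁅e i, J (e i)⁆ (e j)) (J (e j)) = 0 := by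
    rw [Finset.sum_comm]
    refine Finset.sum_eq_zero fun j _ => ?_
    have := congrArg (fun v => B (nabla v (e j)) (J (e j))) (h.sum_lie_J hu he)
    simpa only [map_sum, LinearMap.sum_apply, map_zero, LinearMap.zero_apply] using this
  simp only [curvature, map_sub, LinearMap.sub_apply, Finset.sum_sub_distrib, hlie, sub_zero]
  exact sub_eq_zero.2 (Finset.sum_congr rfl fun i _ => htr _ _)

/-- The scalar curvature of a unimodular Kähler Lie algebra vanishes. -/
theorem IsKahler.sum_curvature [FiniteDimensional ℝ g] (h : IsKahler J B)
    {nabla : g →ₗ[ℝ] g →ₗ[ℝ] g}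
    (hn : IsLeviCivita B nabla) (hu : IsUnimodular g) (he : IsOrthonormal B e) :
    ∑ i, ∑ j, B (curvature nabla (e i) (e j) (e i)) (e j) = 0 := by
  have hH := h.hermitian
  have hRJ : ∀ x y z, curvature nabla x y (J z) = J (curvature nabla x y z) := by
    intro x y z
    simp only [curvature, h.nabla_J hn, map_sub]
  -- By Bianchi and `J`-linearity of the curvature, the Ricci-form term splits in two. Summed over
  -- the basis, the two have equal totals, so the vanishing trace is twice the scalar expression.
  have hpt : ∀ x y, B (curvature nabla x (J x) y) (J y) =
      B (curvature nabla (J x) y (J x)) y + B (curvature nabla x y x) y := by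
    intro x y
    have b := congrArg (fun v => B v (J y)) (hn.bianchi x (J x) y)
    simp only [map_add, LinearMap.add_apply, map_zero, LinearMap.zero_apply] at b
    have hs : curvature nabla y x (J x) = -curvature nabla x y (J x) := by
      simp only [curvature]
      rw [← lie_skew x y, map_neg, LinearMap.neg_apply]
      abel
    rw [hs, hRJ x y, map_neg, LinearMap.neg_apply, hH.compat] at b
    rw [hRJ, hH.skew]
    linarith
  have hJ : ∀ j, ∑ i, B (curvature nabla (J (e i)) (e j) (J (e i))) (e j) =
      ∑ i, B (curvature nabla (e i) (e j) (e i)) (e j) := by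
    intro j
    exact hH.sum_comp he (LinearMap.mk₂ ℝ (fun x y => B (curvature nabla x (e j) y) (e j))
      (fun x x' y => by
        simp only [curvature, map_add, map_sub, add_lie, LinearMap.add_apply, LinearMap.sub_apply]
        ring)
      (fun a x y => by
        simp only [curvature, map_smul, map_sub, smul_lie, LinearMap.smul_apply,
          LinearMap.sub_apply, smul_eq_mul]
        ring)
      (fun x y y' => by
        simp only [curvature, map_add, map_sub, LinearMap.add_apply, LinearMap.sub_apply]
        ring)
      (fun a x y => by
        simp only [curvature, map_smul, map_sub, LinearMap.smul_apply,
          LinearMap.sub_apply, smul_eq_mul]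
        ring))
  have h0 := h.sum_curvature_J hn hu he
  simp only [hpt, Finset.sum_add_distrib] at h0
  rw [Finset.sum_comm] at h0
  simp only [hJ] at h0
  rw [Finset.sum_comm] at h0
  linarith

/-- The scalar curvature, up to sign, in terms of Christoffel symbols. -/
theorem IsLeviCivita.sum_christoffel {nabla : g →ₗ[ℝ] g →ₗ[ℝ] g} (hB : IsInnerProduct B)
    (hn : IsLeviCivita B nabla) (hu : IsUnimodular g) (he : IsOrthonormal B e) :
    ∑ i, ∑ j, B (curvature nabla (e i) (e j) (e i)) (e j) =
      ∑ i, ∑ j, ∑ k, B (nabla (e i) (e j)) (e k) * B (nabla (e j) (e i)) (e k) := by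
  set Γ : ι → ι → ι → ℝ := fun i j k => B (nabla (e i) (e j)) (e k) with hΓ
  have hskew : ∀ i j k, Γ i j k = -Γ i k j := by
    intro i j k
    have := hn.metric (e i) (e j) (e k)
    rw [hB.symm (e j)] at this
    simp only [hΓ]
    linarith
  have h1 : ∀ i j, B (nabla (e i) (nabla (e j) (e i))) (e j) = -∑ k, Γ i j k * Γ j i k := by
    intro i j
    have := hn.metric (e i) (nabla (e j) (e i)) (e j)
    simp only [hΓ]
    rw [he.sum_mul hB.symm, hB.symm]
    rw [hB.symm (e j)]
    linarith [hB.symm (nabla (e j) (e i)) (nabla (e i) (e j))]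
  -- Unimodularity enters only here, through `∑ ∇_{e i} e i = 0`.
  have h2 : ∑ i, ∑ j, B (nabla (e j) (nabla (e i) (e i))) (e j) = 0 := by
    rw [Finset.sum_comm]
    refine Finset.sum_eq_zero fun j _ => ?_
    have := congrArg (fun v => B (nabla (e j) v) (e j)) (hn.sum_nabla_self hB hu he)
    simpa only [map_sum, LinearMap.sum_apply, map_zero, LinearMap.zero_apply] using this
  have h3 : ∀ i j, B (nabla ⁅e i, e j⁆ (e i)) (e j) =
      ∑ k, (Γ i j k * Γ k i j - Γ j i k * Γ k i j) := by
    intro i j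
    conv_lhs => rw [← he.sum_smul ⁅e i, e j⁆]
    simp only [map_sum, map_smul, LinearMap.sum_apply, LinearMap.smul_apply, smul_eq_mul,
      ← hn.torsion_free, map_sub, LinearMap.sub_apply, sub_mul, hΓ]
  have e1 := sum_mul_rotate_of_skew hskew
  have e2 := sum_mul_transpose_of_skew hskew
  simp only [curvature, map_sub, LinearMap.sub_apply, Finset.sum_sub_distrib, h1, h2, h3, e1, e2,
    Finset.sum_neg_distrib]
  ring

/-- A metric Lie algebra with an orthogonal splitting into two abelian parts, the one containing
the derived algebra being acted on by skew endomorphisms, is flat. -/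
theorem isFlat_of_splitting (p : g →ₗ[ℝ] g) (hlie : ∀ x y : g, p ⁅x, y⁆ = ⁅x, y⁆)
    (hB : IsInnerProduct B) (hsym : ∀ x y, B (p x) y = B x (p y))
    (hp : ∀ x y, ⁅p x, p y⁆ = 0) (hq : ∀ x y, ⁅x - p x, y - p y⁆ = 0)
    (hpq : ∀ x y z, B ⁅x - p x, p y⁆ (p z) + B ⁅x - p x, p z⁆ (p y) = 0) : IsFlat B := by
  -- Only the complement differentiates, and only the part in the image of `p`. Brackets are fixed
  -- by `p`, so `∇` along a bracket is zero, and the operators `∇_x` commute because the complement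
  -- is abelian.
  refine ⟨LinearMap.mk₂ ℝ (fun x y => ⁅x - p x, p y⁆) ?_ ?_ ?_ ?_, ⟨?_, ?_⟩, ?_⟩
  · intro x x' y
    rw [map_add, ← add_lie]; congr 1; abel
  · intro a x y
    rw [map_smul, ← smul_sub, smul_lie]
  · intro x y y'
    rw [map_add, lie_add]
  · intro a x y
    rw [map_smul, lie_smul]
  · intro x y
    have h1 := hp x y
    have h2 := hq x y
    simp only [LinearMap.mk₂_apply, sub_lie, lie_sub] at h2 ⊢
    rw [h1] at h2 ⊢
    rw [hp y x, ← lie_skew y (p x), sub_zero, sub_zero, sub_neg_eq_add]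
    have h3 : ⁅x, y⁆ = ⁅x, p y⁆ + ⁅p x, y⁆ := by
      rw [← sub_eq_zero, ← h2]; abel
    exact h3.symm
  · intro x y z
    have h := hpq x y z
    rw [← hsym, ← hsym, hlie, hlie] at h
    rw [LinearMap.mk₂_apply, LinearMap.mk₂_apply, hB.symm y]
    exact h
  · intro x y z
    simp only [LinearMap.mk₂_apply, hlie, sub_self, zero_lie, sub_zero]
    rw [← lie_lie, hq, zero_lie]

/-- A unimodular solvable Kähler Lie algebra is flat. -/
theorem IsKahler.isFlat_of_isUnimodular [FiniteDimensional ℝ g] (h : IsKahler J B)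
    (hu : IsUnimodular g) [LieAlgebra.IsSolvable g] : IsFlat B := by
  have hH := h.hermitian
  have hs := hH.inner.symm
  obtain ⟨nabla, hn, -⟩ := hH.inner.existsUnique_leviCivita
  set W : Submodule ℝ g := Submodule.span ℝ {m : g | ∃ x y : g, ⁅x, y⁆ = m} with hW
  have hmem : ∀ x y : g, ⁅x, y⁆ ∈ W := fun x y => Submodule.subset_span ⟨x, y, rfl⟩
  obtain ⟨a, b, e, he, heW, heW'⟩ := exists_adapted_orthonormal_basis hs hH.inner.pos W
  set Γ : Fin a ⊕ Fin b → Fin a ⊕ Fin b → Fin a ⊕ Fin b → ℝ :=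
    fun i j k => B (nabla (e i) (e j)) (e k) with hΓ
  have hΓskew : ∀ i j k, Γ i j k = -Γ i k j := by
    intro i j k
    have := hn.metric (e i) (e j) (e k)
    rw [hs (e j)] at this
    simp only [hΓ]
    linarith
  have hc : ∀ i j k, Γ i j k - Γ j i k = B ⁅e i, e j⁆ (e k) := by
    intro i j k
    rw [← hn.torsion_free, map_sub, LinearMap.sub_apply]
  have hT := sum_sq_add_two_mul_sum_eq hΓskew
  -- Two evaluations of the scalar curvature meet: Kähler geometry makes it zero, and the
  -- Christoffel formula expresses it in structure constants.
  rw [show ∑ i, ∑ j, ∑ k, Γ i j k * Γ j i k = 0 from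
    (hn.sum_christoffel hH.inner hu he).symm.trans (h.sum_curvature hn hu he), mul_zero] at hT
  simp only [hc] at hT
  obtain ⟨hNN, hAA, hAN⟩ := structureConstants_eq_zero
    (c := fun i j k => B ⁅e i, e j⁆ (e k))
    (fun i j k => by rw [← lie_skew, map_neg, LinearMap.neg_apply])
    (fun i j k => heW' k _ (hmem _ _))
    (fun i => by
      have hk := trace_ad_comp_ad_eq_zero_of_mem_span_lie (heW i)
      rw [he.trace_eq] at hk
      rw [← hk]
      refine Finset.sum_congr rfl fun j _ => ?_
      simp only [LinearMap.comp_apply, LieAlgebra.ad_apply]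
      conv_rhs => rw [← he.sum_smul ⁅e (Sum.inl i), e j⁆]
      simp only [lie_sum, lie_smul, map_sum, map_smul, LinearMap.sum_apply, LinearMap.smul_apply,
        smul_eq_mul])
    hT
  -- The orthogonal projection onto the derived algebra, for which the vanishing structure constants
  -- give the required splitting.
  let p : g →ₗ[ℝ] g := e.constr ℝ (Sum.elim (fun i => e (Sum.inl i)) fun _ => 0)
  have hpl : ∀ i, p (e (Sum.inl i)) = e (Sum.inl i) := fun i => by simp [p]
  have hpr : ∀ i, p (e (Sum.inr i)) = 0 := fun i => by simp [p]
  have hzero : ∀ {i j}, (∀ k, B ⁅e i, e j⁆ (e (Sum.inl k)) = 0) → ⁅e i, e j⁆ = 0 := by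
    intro i j hk
    refine he.ext fun k => ?_
    rw [map_zero, LinearMap.zero_apply]
    rcases k with k | k
    · exact hk k
    · exact heW' k _ (hmem _ _)
  refine isFlat_of_splitting p ?_ hH.inner ?_ ?_ ?_ ?_
  · intro x y
    have hsum := he.sum_smul ⁅x, y⁆
    simp only [Fintype.sum_sum_type, heW' _ _ (hmem x y), zero_smul, Finset.sum_const_zero,
      add_zero] at hsum
    rw [← hsum]
    simp only [map_sum, map_smul, hpl]
  · suffices B ∘ₗ p = B.compl₂ p from fun x y => LinearMap.congr_fun₂ this x y
    refine LinearMap.BilinForm.ext_basis e ?_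
    rintro (i | i) (j | j) <;> simp [hpl, hpr, he _ _]
  · suffices (LieModule.toEnd ℝ g g : g →ₗ[ℝ] g →ₗ[ℝ] g).compl₁₂ p p = 0 from
      fun x y => LinearMap.congr_fun₂ this x y
    refine e.ext fun i => e.ext fun j => ?_
    rcases i with i | i <;> rcases j with j | j <;> simp [hpl, hpr]
    exact hzero (hNN i j)
  · suffices (LieModule.toEnd ℝ g g : g →ₗ[ℝ] g →ₗ[ℝ] g).compl₁₂ (LinearMap.id - p)
        (LinearMap.id - p) = 0 from
      fun x y => LinearMap.congr_fun₂ this x y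
    refine e.ext fun i => e.ext fun j => ?_
    rcases i with i | i <;> rcases j with j | j <;> simp [hpl, hpr]
    exact hzero (hAA i j)
  · intro x
    suffices B.compl₁₂ (LieModule.toEnd ℝ g g (x - p x) ∘ₗ p) p +
        (B.compl₁₂ (LieModule.toEnd ℝ g g (x - p x) ∘ₗ p) p).flip = 0 from
      fun y z => LinearMap.congr_fun₂ this y z
    refine LinearMap.BilinForm.ext_basis e fun j k => ?_
    have hx : ∀ j k, B ⁅x - p x, e (Sum.inl j)⁆ (e (Sum.inl k)) +
        B ⁅x - p x, e (Sum.inl k)⁆ (e (Sum.inl j)) = 0 := by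
      intro j k
      suffices B.flip (e (Sum.inl k)) ∘ₗ
          (LieModule.toEnd ℝ g g : g →ₗ[ℝ] g →ₗ[ℝ] g).flip (e (Sum.inl j)) ∘ₗ (LinearMap.id - p) +
          B.flip (e (Sum.inl j)) ∘ₗ
          (LieModule.toEnd ℝ g g : g →ₗ[ℝ] g →ₗ[ℝ] g).flip (e (Sum.inl k)) ∘ₗ (LinearMap.id - p) =
          0 from LinearMap.congr_fun this x
      refine e.ext fun i => ?_
      rcases i with i | i <;> simp [hpl, hpr]
      exact hAN i j k
    generalize x - p x = w at hx ⊢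
    rcases j with j | j <;> rcases k with k | k <;> simp [hpl, hpr]
    exact hx j k

end KahlerFlat

/-! ### Vaisman identities and centrality of `J A`. -/

section Vaisman

open Module

variable {g : Type u} [LieRing g] [LieAlgebra ℝ g] {J : g →ₗ[ℝ] g} {B : LinearMap.BilinForm ℝ g}
  {θ : Module.Dual ℝ g} {A : g}

theorem IsLCK.lee_lie (h : IsLCK J B θ) (x y : g) : θ ⁅x, y⁆ = 0 :=
  neg_eq_zero.1 (h.lee_closed x y)

theorem IsLCK.inner_lie (h : IsLCK J B θ) (hA : ∀ x, θ x = B A x) (x y : g) : B A ⁅x, y⁆ = 0 := by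
  rw [← hA, h.lee_lie]

theorem IsHermitian.inner_J_self (h : IsHermitian J B) (x : g) : B x (J x) = 0 := by
  have := h.skew x x
  rw [h.inner.symm] at this
  linarith

theorem IsInnerProduct.eq_zero_of_sum (hB : IsInnerProduct B) {ι : Type*} [Fintype ι]
    {e : Basis ι ℝ g} {f : g →ₗ[ℝ] g} (h : ∑ i, B (f (e i)) (f (e i)) = 0) : f = 0 := by
  have hnn : ∀ y, 0 ≤ B y y := fun y => by
    by_cases hy : y = 0
    · simp [hy]
    · exact (hB.pos y hy).le
  have h' := (Fintype.sum_eq_zero_iff_of_nonneg (fun i => hnn _)).1 h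
  refine e.ext fun i => ?_
  by_contra hne
  exact (hB.pos _ hne).ne' (congrFun h' i)

/-- Parallelism of `θ` means `∇A = 0`. As `θ` kills brackets, the Koszul formula leaves just the
symmetric part of `ad A`. -/
theorem IsVaisman.ad_skew (h : IsVaisman J B θ) (hA : ∀ x, θ x = B A x) (x y : g) :
    B ⁅A, x⁆ y = -B ⁅A, y⁆ x := by
  have hB := h.hermitian.inner
  obtain ⟨nabla, hn, hp⟩ := h.parallel
  have h1 := hn.metric x A y
  have h2 := hp x y
  rw [hA] at h2
  rw [hn.koszul hB, ← lie_skew x A, map_neg, LinearMap.neg_apply, hB.symm ⁅y, x⁆,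
    h.inner_lie hA] at h1
  linarith

/-- Integrability paired with `J A` shows that `⟨J A, [y, z]⟩` is `J`-invariant, because brackets
are orthogonal to `A`. Comparing the equation for `dω` at `(A, y, z)` and `(A, J y, J z)` then
isolates `ad A`. -/
theorem IsVaisman.lie_J (h : IsVaisman J B θ) (hA : ∀ x, θ x = B A x) (y : g) :
    ⁅A, J y⁆ = J ⁅A, y⁆ := by
  have hH := h.hermitian
  have hB := hH.inner
  refine hB.eq_of_forall fun z => ?_
  have s1 := h.ad_skew hA (J y) z
  have s2 := h.ad_skew hA y (J z)
  have d1 := h.lck A y z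
  have d2 := h.lck A (J y) (J z)
  have n1 := congrArg (fun v => B v (J A)) (hH.integrable y z)
  have r : ∀ x, B x (J A) = -B A (J x) := fun x => by rw [hB.symm, hH.skew]
  have hl : ∀ x y : g, B ⁅x, y⁆ A = 0 := fun x y => by rw [hB.symm, h.inner_lie hA]
  simp only [d₂, wedge, fundamentalForm, LinearMap.comp_apply, hH.skew, hH.sq, map_neg, hA,
    ← lie_skew z A, ← lie_skew (J z) A, LinearMap.neg_apply, r z,
    hB.symm z A] at d1 d2
  simp only [map_sub, map_add, LinearMap.sub_apply, LinearMap.add_apply, map_zero,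
    LinearMap.zero_apply, hH.compat, hl] at n1
  rw [hH.skew]
  linarith

theorem IsVaisman.lie_J_self (h : IsVaisman J B θ) (hA : ∀ x, θ x = B A x) : ⁅A, J A⁆ = 0 := by
  rw [h.lie_J hA, lie_self, map_zero]

/-- The differential of the form dual to `J A`. -/
theorem IsVaisman.inner_J_lie (h : IsVaisman J B θ) (hA : ∀ x, θ x = B A x) (hA1 : B A A = 1)
    (x y : g) : B (J A) ⁅x, y⁆ = B (J x) y - B A x * B (J A) y + B (J A) x * B A y := by
  have hH := h.hermitian
  have d := h.lck A x y
  simp only [d₂, wedge, fundamentalForm, LinearMap.comp_apply, hA, hA1] at d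
  -- The two terms of `dω` containing `ad A` cancel, as `ad A` is skew and commutes with `J`; `⟨J A,
  -- [x, y]⟩` remains.
  rw [← h.lie_J hA, h.ad_skew hA, ← lie_skew y A, map_neg, map_neg, LinearMap.neg_apply,
    hH.skew ⁅A, y⁆, hH.skew ⁅x, y⁆, hH.skew y A, hH.inner.symm _ (J A), hH.inner.symm y] at d
  linarith

/-- Integrability with first argument `A` makes `ad (J A)` commute with `J`. At `(J A, x, J y)` the
form `θ ∧ ω` vanishes, and `dω` becomes the symmetric part of `ad (J A)`. -/
theorem IsVaisman.ad_J_skew (h : IsVaisman J B θ) (hA : ∀ x, θ x = B A x) (x y : g) :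
    B ⁅J A, x⁆ y = -B x ⁅J A, y⁆ := by
  have hH := h.hermitian
  have hn := hH.integrable A y
  rw [h.lie_J hA, map_add, hH.sq] at hn
  have hJ : ⁅J A, J y⁆ = J ⁅J A, y⁆ := by
    rw [← sub_eq_zero, ← hn]; abel
  have d := h.lck (J A) x (J y)
  simp only [d₂, wedge, fundamentalForm, LinearMap.comp_apply, hA, hH.inner_J_self, hH.compat,
    hH.sq, ← lie_skew (J y), hJ, map_neg, LinearMap.neg_apply,
    hH.inner.symm _ A, h.inner_lie hA] at d
  rw [hH.inner.symm x]
  rw [hH.inner.symm y, hH.skew A y] at d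
  linarith

/-- The orthogonal projection onto the complement of the span of `A` and `J A`. -/
def transverseProj (J : g →ₗ[ℝ] g) (B : LinearMap.BilinForm ℝ g) (A : g) : g →ₗ[ℝ] g :=
  LinearMap.id - (B A).smulRight A - (B (J A)).smulRight (J A)

theorem transverseProj_apply (x : g) :
    transverseProj J B A x = x - B A x • A - B (J A) x • J A := rfl

theorem IsHermitian.inner_transverseProj (h : IsHermitian J B) (hA1 : B A A = 1) (x : g) :
    B A (transverseProj J B A x) = 0 := by
  simp only [transverseProj_apply, map_sub, map_smul, smul_eq_mul, hA1, h.inner_J_self]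
  ring

theorem IsHermitian.inner_J_transverseProj (h : IsHermitian J B) (hA1 : B A A = 1) (x : g) :
    B (J A) (transverseProj J B A x) = 0 := by
  simp only [transverseProj_apply, map_sub, map_smul, smul_eq_mul, h.compat, hA1,
    h.inner.symm (J A) A, h.inner_J_self]
  ring

theorem IsHermitian.transverseProj_J (h : IsHermitian J B) (x : g) :
    transverseProj J B A (J x) = J (transverseProj J B A x) := by
  simp only [transverseProj_apply, map_sub, map_smul, h.sq, h.compat, h.skew A x, map_neg, smul_neg,
    neg_smul]
  abel

theorem transverseProj_of_orthogonal {x : g} (h1 : B A x = 0) (h2 : B (J A) x = 0) :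
    transverseProj J B A x = x := by
  rw [transverseProj_apply, h1, h2, zero_smul, zero_smul, sub_zero, sub_zero]

theorem IsHermitian.transverseProj_symm (h : IsHermitian J B) (x y : g) :
    B (transverseProj J B A x) y = B x (transverseProj J B A y) := by
  simp only [transverseProj_apply, map_sub, map_smul, smul_eq_mul, LinearMap.sub_apply,
    LinearMap.smul_apply, h.inner.symm x A, h.inner.symm x (J A)]
  ring

variable [FiniteDimensional ℝ g]

/-- On a unimodular Vaisman Lie algebra, either `J A` lies in the derived algebra or the algebra
is spanned by `A` and `J A`. -/
theorem IsVaisman.transverseProj_eq_zero (h : IsVaisman J B θ) (hu : IsUnimodular g)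
    (hA : ∀ x, θ x = B A x) (hA1 : B A A = 1)
    (hmem : J A ∉ Submodule.span ℝ {m : g | ∃ x y : g, ⁅x, y⁆ = m}) (x : g) :
    transverseProj J B A x = 0 := by
  have hH := h.hermitian
  have hB := hH.inner
  obtain ⟨f, hf, hfJ⟩ : ∃ f : Module.Dual ℝ g, (∀ x y : g, f ⁅x, y⁆ = 0) ∧
      f (J A) = 1 := by
    obtain ⟨f, hf1, hf2⟩ := Submodule.exists_le_ker_of_notMem hmem
    refine ⟨(f (J A))⁻¹ • f, fun x y => ?_, ?_⟩
    · rw [LinearMap.smul_apply, LinearMap.mem_ker.1 (hf2 (Submodule.subset_span ⟨x, y, rfl⟩)),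
        smul_zero]
    · rw [LinearMap.smul_apply, smul_eq_mul, inv_mul_cancel₀ hf1]
  obtain ⟨v, hv⟩ : ∃ v, ∀ x, f x = B v x :=
    ⟨(LinearMap.BilinForm.toDual B hB.nondegenerate).symm f, fun x =>
      (LinearMap.BilinForm.apply_toDual_symm_apply (hB := hB.nondegenerate) f x).symm⟩
  -- Chosen so that `J w` is minus the transverse part of `v`, hence pairs with brackets exactly as
  -- `J A` does.
  set w := transverseProj J B A (J v) with hw
  have hwA : B A w = 0 := hH.inner_transverseProj hA1 _
  have hwJ : B (J A) w = 0 := hH.inner_J_transverseProj hA1 _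
  have hw1 : ∀ y, B (J A) ⁅w, y⁆ = B (J w) y := by
    intro y
    rw [h.inner_J_lie hA hA1, hwA, hwJ]
    ring
  have hw2 : ∀ x y : g, B (J w) ⁅x, y⁆ = B (J A) ⁅x, y⁆ := by
    intro x y
    rw [hw, ← hH.transverseProj_J, hH.sq, hH.transverseProj_symm, map_neg, LinearMap.neg_apply,
      ← hv, transverseProj_apply, map_sub, map_sub, map_smul, map_smul, hf, hfJ, h.inner_lie hA]
    simp
  -- By Jacobi, `w` acts like a Liouville field on `⟨J A, [x, y]⟩`. Tracing over `y = J x` gives the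
  -- dimension of the transverse space on the left and multiples of `tr (ad w) = 0` on the right.
  have key : ∀ x y : g, B (J A) ⁅x, y⁆ = B (J A) ⁅⁅w, x⁆, y⁆ + B (J A) ⁅x, ⁅w, y⁆⁆ := by
    intro x y
    rw [← map_add, ← leibniz_lie, hw1, hw2]
  have hΩ : ∀ u x : g, B (J A) ⁅u, J x⁆ = B u x - B A u * B A x - B (J A) u * B (J A) x := by
    intro u x
    rw [h.inner_J_lie hA hA1, hH.compat, hH.compat, hH.skew A x]
    ring
  obtain ⟨e, he⟩ := exists_orthonormal_basis hB.symm hB.pos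
  have htr := hu w
  rw [he.trace_eq] at htr
  simp only [LieAlgebra.ad_apply] at htr
  have htr' := hH.sum_comp he (B ∘ₗ LieAlgebra.ad ℝ g w)
  simp only [LinearMap.comp_apply, LieAlgebra.ad_apply, htr] at htr'
  have h1 : ∑ i, B (J A) ⁅⁅w, e i⁆, J (e i)⁆ = 0 := by
    simp only [hΩ, h.inner_lie hA, hw1, Finset.sum_sub_distrib, htr, he.sum_mul hB.symm, hH.compat,
      hB.symm w A, hwA]
    simp
  have h2 : ∑ i, B (J A) ⁅e i, ⁅w, J (e i)⁆⁆ = 0 := by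
    simp only [h.inner_J_lie hA hA1 (e _) ⁅_, _⁆, h.inner_lie hA, hw1, hH.compat, hB.symm (J (e _)),
      Finset.sum_add_distrib, Finset.sum_sub_distrib, htr', he.sum_mul hB.symm, hwA]
    simp
  have h3 : ∑ i, B (transverseProj J B A (e i)) (transverseProj J B A (e i)) = 0 := by
    have h0 := congrArg₂ (· + ·) h1 h2
    simp only [← Finset.sum_add_distrib, ← key, add_zero] at h0
    simp only [hΩ] at h0
    rw [← h0]
    refine Finset.sum_congr rfl fun i _ => ?_
    rw [hH.transverseProj_symm, transverseProj_of_orthogonal (hH.inner_transverseProj hA1 _)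
      (hH.inner_J_transverseProj hA1 _), transverseProj_apply]
    simp only [map_sub, map_smul, smul_eq_mul, hB.symm (e i) A, hB.symm (e i) (J A)]
  rw [hB.eq_zero_of_sum h3, LinearMap.zero_apply]

/-- On a unimodular solvable Vaisman Lie algebra `J A` is central. -/
theorem IsVaisman.J_lie_eq_zero (h : IsVaisman J B θ) (hu : IsUnimodular g)
    [LieAlgebra.IsSolvable g] (hA : ∀ x, θ x = B A x) (hA1 : B A A = 1) (x : g) :
    ⁅J A, x⁆ = 0 := by
  have hB := h.hermitian.inner
  by_cases hmem : J A ∈ Submodule.span ℝ {m : g | ∃ x y : g, ⁅x, y⁆ = m}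
  · obtain ⟨e, he⟩ := exists_orthonormal_basis hB.symm hB.pos
    have htr := trace_ad_comp_ad_eq_zero_of_mem_span_lie hmem
    rw [he.trace_eq] at htr
    simp only [LinearMap.comp_apply, LieAlgebra.ad_apply, h.ad_J_skew hA ⁅J A, _⁆,
      Finset.sum_neg_distrib, neg_eq_zero] at htr
    exact LinearMap.congr_fun (hB.eq_zero_of_sum (f := LieAlgebra.ad ℝ g (J A)) htr) x
  · have hx := h.transverseProj_eq_zero hu hA hA1 hmem x
    rw [transverseProj_apply, sub_sub, sub_eq_zero] at hx
    rw [hx, lie_add, lie_smul, lie_smul, lie_self, ← lie_skew, h.lie_J_self hA]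
    simp

end Vaisman

/-! ### Maps out of a double extension. -/

section DoubleExtensionLift

attribute [local instance] LieRing.ofAssociativeRing LieAlgebra.ofAssociativeAlgebra

variable {k : Type u} [LieRing k] [LieAlgebra ℝ k] {β : ClosedTwoForm k}

/-- The homomorphism out of a double extension defined by a homomorphism `φ` out of the central
extension and an element `A` that acts on the image of `φ` through the derivation `D`. -/
def DoubleExtension.lift {g : Type u} [LieRing g] [LieAlgebra ℝ g]
    (D : LieDerivation ℝ (CentralExtension β) (CentralExtension β))
    (φ : CentralExtension β →ₗ⁅ℝ⁆ g) (A : g) (hφ : ∀ z, φ (D z) = ⁅A, φ z⁆) :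
    DoubleExtension D →ₗ⁅ℝ⁆ g where
  toFun z := z.right • A + φ z.left
  map_add' z w := by
    change (z.right + w.right) • A + φ (z.left + w.left) = _
    rw [add_smul, map_add]
    abel
  map_smul' c z := by
    change (c * z.right) • A + φ (c • z.left) = _
    rw [mul_smul, map_smul, RingHom.id_apply, smul_add]
  map_lie' {z w} := by
    change ⁅z.right, w.right⁆ • A +
      φ (⁅z.left, w.left⁆ + z.right • D w.left - w.right • D z.left) = _
    rw [map_sub, map_add, map_smul, map_smul, hφ, hφ, LieHom.map_lie,
      LieRing.of_associative_ring_bracket, mul_comm, sub_self, zero_smul, zero_add]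
    simp only [lie_add, add_lie, lie_smul, smul_lie, lie_self, smul_zero, zero_add]
    rw [← lie_skew (φ z.left) A, smul_neg]
    abel

theorem DoubleExtension.exists_equiv {g : Type u} [LieRing g] [LieAlgebra ℝ g]
    (D : LieDerivation ℝ (CentralExtension β) (CentralExtension β))
    (φ : CentralExtension β →ₗ⁅ℝ⁆ g) (A : g) (hφ : ∀ z, φ (D z) = ⁅A, φ z⁆)
    (hinj : Function.Injective φ) (θ : Module.Dual ℝ g) (hA : θ A = 1)
    (hker : ∀ x, θ x = 0 ↔ ∃ z, φ z = x) :
    ∃ Ψ : DoubleExtension D ≃ₗ⁅ℝ⁆ g, Ψ (DoubleExtension.gen D) = A ∧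
      ∀ z, Ψ (DoubleExtension.incl D z) = φ z := by
  have hθφ : ∀ z, θ (φ z) = 0 := fun z => (hker _).2 ⟨z, rfl⟩
  have hbij : Function.Bijective (DoubleExtension.lift D φ A hφ) := by
    constructor
    · rw [← LieHom.coe_toLinearMap, ← LinearMap.ker_eq_bot, LinearMap.ker_eq_bot']
      intro z hz
      change z.right • A + φ z.left = 0 at hz
      have h1 := congrArg θ hz
      rw [map_add, map_smul, hA, hθφ, map_zero, smul_eq_mul, mul_one, add_zero] at h1
      rw [h1, zero_smul, zero_add] at hz
      have h2 : z.left = 0 := hinj (hz.trans (map_zero φ).symm)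
      exact LieAlgebra.SemiDirectSum.ext h2 h1
    · intro x
      obtain ⟨z, hz⟩ := (hker (x - θ x • A)).1 (by
        rw [map_sub, map_smul, hA, smul_eq_mul, mul_one, sub_self])
      refine ⟨(⟨z, θ x⟩ : LieAlgebra.SemiDirectSum (CentralExtension β) ℝ (lineAction D)), ?_⟩
      change θ x • A + φ z = x
      rw [hz, add_sub_cancel]
  refine ⟨LieEquiv.ofBijective _ hbij, ?_, fun z => ?_⟩
  · change (1 : ℝ) • A + φ 0 = A
    rw [one_smul, map_zero, add_zero]
  · change (0 : ℝ) • A + φ z = φ z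
    rw [zero_smul, zero_add]

end DoubleExtensionLift

/-! ### The transverse Kähler algebra and its extensions. -/

section Transverse

theorem lie_eq_zero_of_forall_lie_eq_zero {g : Type*} [LieRing g] {a : g}
    (ha : ∀ x : g, ⁅a, x⁆ = 0) (x : g) : ⁅x, a⁆ = 0 := by
  rw [← lie_skew, ha, neg_zero]

variable {g : Type u} [LieRing g] [LieAlgebra ℝ g] {J : g →ₗ[ℝ] g} {B : LinearMap.BilinForm ℝ g}
  {θ : Module.Dual ℝ g} {A : g}

/-- The orthogonal complement of the span of `A` and `J A` in a Vaisman Lie algebra in which `J A`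
is central, with the bracket obtained by orthogonal projection. -/
def Transverse (_ : IsVaisman J B θ) (_ : ∀ x, θ x = B A x) (_ : B A A = 1)
    (_ : ∀ x : g, ⁅J A, x⁆ = 0) : Type u :=
  (LinearMap.ker (B A) ⊓ LinearMap.ker (B (J A)) : Submodule ℝ g)

namespace Transverse

variable (h : IsVaisman J B θ) (hA : ∀ x, θ x = B A x) (hA1 : B A A = 1)
  (hc : ∀ x : g, ⁅J A, x⁆ = 0)

instance : AddCommGroup (Transverse h hA hA1 hc) :=
  inferInstanceAs
    (AddCommGroup (LinearMap.ker (B A) ⊓ LinearMap.ker (B (J A)) : Submodule ℝ g))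

instance : Module ℝ (Transverse h hA hA1 hc) :=
  inferInstanceAs (Module ℝ (LinearMap.ker (B A) ⊓ LinearMap.ker (B (J A)) : Submodule ℝ g))

/-- The inclusion as a subspace. -/
def incl : Transverse h hA hA1 hc →ₗ[ℝ] g :=
  (LinearMap.ker (B A) ⊓ LinearMap.ker (B (J A))).subtype

/-- The orthogonal projection. -/
def proj : g →ₗ[ℝ] Transverse h hA hA1 hc :=
  (transverseProj J B A).codRestrict (LinearMap.ker (B A) ⊓ LinearMap.ker (B (J A)))
    fun x => ⟨h.hermitian.inner_transverseProj hA1 x, h.hermitian.inner_J_transverseProj hA1 x⟩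

instance : Bracket (Transverse h hA hA1 hc) (Transverse h hA hA1 hc) where
  bracket x y := proj h hA hA1 hc ⁅incl h hA hA1 hc x, incl h hA hA1 hc y⁆

variable {h hA hA1 hc}

local notation "ι" => incl h hA hA1 hc
local notation "π" => proj h hA hA1 hc

theorem lie_def (x y : Transverse h hA hA1 hc) : ⁅x, y⁆ = π ⁅ι x, ι y⁆ := rfl

theorem incl_injective : Function.Injective ι := Subtype.val_injective

theorem incl_proj (x : g) : ι (π x) = transverseProj J B A x := rfl

theorem inner_incl (x : Transverse h hA hA1 hc) : B A (ι x) = 0 := x.2.1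

theorem inner_J_incl (x : Transverse h hA hA1 hc) : B (J A) (ι x) = 0 := x.2.2

theorem mem_range_incl (v : g) : v ∈ LinearMap.range ι ↔ B A v = 0 ∧ B (J A) v = 0 := by
  constructor
  · rintro ⟨x, rfl⟩
    exact ⟨inner_incl x, inner_J_incl x⟩
  · intro hv
    exact ⟨π v, transverseProj_of_orthogonal hv.1 hv.2⟩

theorem proj_incl (x : Transverse h hA hA1 hc) : π (ι x) = x :=
  incl_injective (transverseProj_of_orthogonal (inner_incl x) (inner_J_incl x))

/-- The projection removes from a bracket only a multiple of the central `J A`. This transfers the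
Jacobi identity to the projected bracket. -/
theorem proj_lie_proj_lie (x y z : g) : π ⁅x, ι (π ⁅y, z⁆)⁆ = π ⁅x, ⁅y, z⁆⁆ := by
  rw [incl_proj, transverseProj_apply, h.inner_lie hA, zero_smul, sub_zero, lie_sub, lie_smul,
    lie_eq_zero_of_forall_lie_eq_zero hc, smul_zero, sub_zero]

instance : LieRing (Transverse h hA hA1 hc) where
  add_lie x y z := by simp only [lie_def, map_add, add_lie]
  lie_add x y z := by simp only [lie_def, map_add, lie_add]
  lie_self x := by rw [lie_def, lie_self, map_zero]
  leibniz_lie x y z := by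
    simp only [lie_def]
    rw [proj_lie_proj_lie, proj_lie_proj_lie, ← lie_skew (ι (π ⁅ι x, ι y⁆)), map_neg,
      proj_lie_proj_lie, ← map_neg, lie_skew, ← map_add, ← leibniz_lie]

instance : LieAlgebra ℝ (Transverse h hA hA1 hc) where
  lie_smul c x y := by simp only [lie_def, map_smul, lie_smul]

instance [FiniteDimensional ℝ g] : FiniteDimensional ℝ (Transverse h hA hA1 hc) :=
  inferInstanceAs
    (FiniteDimensional ℝ (LinearMap.ker (B A) ⊓ LinearMap.ker (B (J A)) : Submodule ℝ g))

/-- The bracket of `g` on the transverse subspace. -/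
theorem lie_incl (x y : Transverse h hA hA1 hc) :
    ⁅ι x, ι y⁆ = B (J (ι x)) (ι y) • J A + ι ⁅x, y⁆ := by
  rw [lie_def, incl_proj, transverseProj_apply, h.inner_lie hA, h.inner_J_lie hA hA1,
    inner_incl, inner_J_incl, inner_incl]
  simp

variable (h hA hA1 hc)

/-- The restriction of `J`. -/
def complexStructure : Transverse h hA hA1 hc →ₗ[ℝ] Transverse h hA hA1 hc := π ∘ₗ J ∘ₗ ι

/-- The restriction of the inner product. -/
def inner : LinearMap.BilinForm ℝ (Transverse h hA hA1 hc) := B.compl₁₂ ι ι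

variable {h hA hA1 hc}

local notation "Jₜ" => complexStructure h hA hA1 hc
local notation "Bₜ" => inner h hA hA1 hc

theorem inner_apply (x y : Transverse h hA hA1 hc) : Bₜ x y = B (ι x) (ι y) := rfl

theorem incl_complexStructure (x : Transverse h hA hA1 hc) : ι (Jₜ x) = J (ι x) := by
  change ι (π (J (ι x))) = _
  rw [incl_proj, h.hermitian.transverseProj_J, ← incl_proj, proj_incl]

theorem isHermitian : IsHermitian Jₜ Bₜ where
  sq x := incl_injective (by
    rw [incl_complexStructure, incl_complexStructure, h.hermitian.sq, map_neg])
  integrable x y := incl_injective (by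
    have hn := congrArg (transverseProj J B A) (h.hermitian.integrable (ι x) (ι y))
    simp only [map_sub, map_add, map_zero, h.hermitian.transverseProj_J] at hn
    simp only [map_sub, map_add, map_zero, incl_complexStructure, lie_def, incl_proj]
    exact hn)
  inner :=
    { symm := fun x y => h.hermitian.inner.symm _ _
      pos := fun x hx => h.hermitian.inner.pos _ fun h0 =>
        hx (incl_injective (h0.trans (map_zero _).symm)) }
  compat x y := by
    rw [inner_apply, incl_complexStructure, incl_complexStructure, h.hermitian.compat, inner_apply]

theorem fundamentalForm_apply (x y : Transverse h hA hA1 hc) :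
    fundamentalForm Jₜ Bₜ x y = fundamentalForm J B (ι x) (ι y) := by
  change B (ι (Jₜ x)) (ι y) = B (J (ι x)) (ι y)
  rw [incl_complexStructure]

/-- Here `θ ∧ ω` restricts to zero, and the `J A` components of brackets are invisible because `ω (J
A, ·)` is zero on the transverse space. -/
theorem isKahler : IsKahler Jₜ Bₜ where
  hermitian := isHermitian
  closed x y z := by
    have d := h.lck (ι x) (ι y) (ι z)
    have hz : ∀ z : Transverse h hA hA1 hc, fundamentalForm J B (J A) (ι z) = 0 := by
      intro z
      change B (J (J A)) (ι z) = 0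
      rw [h.hermitian.sq, map_neg, LinearMap.neg_apply, inner_incl, neg_zero]
    simp only [d₂, wedge, hA, inner_incl, zero_mul, add_zero, lie_incl, map_add, map_smul,
      LinearMap.add_apply, LinearMap.smul_apply, hz, smul_zero, zero_add] at d
    simpa only [d₂, fundamentalForm_apply] using d

/-- By cyclicity the trace is that of `ad x` composed with the projection. This differs from `ad x`
by a rank-one map of trace `⟨A, [x, A]⟩ = 0`. -/
theorem isUnimodular [FiniteDimensional ℝ g] (hu : IsUnimodular g) :
    IsUnimodular (Transverse h hA hA1 hc) := by
  intro x
  have h1 : LieAlgebra.ad ℝ (Transverse h hA hA1 hc) x =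
      π ∘ₗ (LieAlgebra.ad ℝ g (ι x) ∘ₗ ι) := rfl
  have h2 : (LieAlgebra.ad ℝ g (ι x) ∘ₗ ι) ∘ₗ π =
      LieAlgebra.ad ℝ g (ι x) - (B A).smulRight ⁅ι x, A⁆ := by
    refine LinearMap.ext fun y => ?_
    change ⁅ι x, transverseProj J B A y⁆ = ⁅ι x, y⁆ - B A y • ⁅ι x, A⁆
    rw [transverseProj_apply, lie_sub, lie_sub, lie_smul, lie_smul,
      lie_eq_zero_of_forall_lie_eq_zero hc,
      smul_zero, sub_zero]
  rw [h1, LinearMap.trace_comp_comm', h2, map_sub, hu, LinearMap.trace_smulRight,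
    h.inner_lie hA, sub_zero]

/-- The projection restricted to `ker θ` is a surjective Lie homomorphism, since there it discards
only multiples of the central `J A`. -/
theorem isSolvable [LieAlgebra.IsSolvable g] :
    LieAlgebra.IsSolvable (Transverse h hA hA1 hc) := by
  let ψ : kerForm θ h.lee_closed →ₗ⁅ℝ⁆ Transverse h hA hA1 hc :=
    { π ∘ₗ (kerForm θ h.lee_closed).toSubmodule.subtype with
      map_lie' := by
        rintro ⟨x, hx⟩ ⟨y, hy⟩
        have hx' : B A x = 0 := (hA x).symm.trans hx
        have hy' : B A y = 0 := (hA y).symm.trans hy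
        change π ⁅x, y⁆ = π ⁅transverseProj J B A x, transverseProj J B A y⁆
        rw [transverseProj_apply, transverseProj_apply, hx', hy']
        simp only [zero_smul, sub_zero, lie_sub, sub_lie, lie_smul, smul_lie, hc,
          lie_eq_zero_of_forall_lie_eq_zero hc, smul_zero] }
  refine Function.Surjective.lieAlgebra_isSolvable (f := ψ) fun x => ?_
  exact ⟨⟨ι x, (hA _).trans (inner_incl x)⟩, proj_incl x⟩

theorem isKahlerFlat [FiniteDimensional ℝ g] [LieAlgebra.IsSolvable g] (hu : IsUnimodular g) :
    IsKahlerFlat Jₜ Bₜ where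
  toIsKahler := isKahler
  flat :=
    have : LieAlgebra.IsSolvable (Transverse h hA hA1 hc) := isSolvable
    isKahler.isFlat_of_isUnimodular (isUnimodular hu)

/-- The kernel of the Lee form is the central extension of the transverse algebra. -/
def kerEquiv (hk : IsKahler Jₜ Bₜ) : CentralExtension hk.form ≃ₗ⁅ℝ⁆ kerForm θ h.lee_closed where
  toFun z := ⟨z.coeff • J A + ι z.base, by
    change θ _ = 0
    rw [hA, map_add, map_smul, h.hermitian.inner_J_self, inner_incl, smul_zero, add_zero]⟩
  map_add' z w := Subtype.ext (by
    change (z.coeff + w.coeff) • J A + ι (z.base + w.base) =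
      (z.coeff • J A + ι z.base) + (w.coeff • J A + ι w.base)
    rw [add_smul, map_add]
    abel)
  map_smul' c z := Subtype.ext (by
    change (c * z.coeff) • J A + ι (c • z.base) = c • (z.coeff • J A + ι z.base)
    rw [mul_smul, map_smul, smul_add])
  map_lie' {z w} := Subtype.ext (by
    change fundamentalForm Jₜ Bₜ z.base w.base • J A + ι ⁅z.base, w.base⁆ =
      ⁅z.coeff • J A + ι z.base, w.coeff • J A + ι w.base⁆
    simp only [add_lie, lie_add, smul_lie, lie_smul, hc,
      lie_eq_zero_of_forall_lie_eq_zero hc, smul_zero, zero_add, lie_incl, fundamentalForm_apply]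
    rfl)
  invFun v := ⟨B (J A) v, π v⟩
  left_inv z := by
    ext
    · change B (J A) (z.coeff • J A + ι z.base) = z.coeff
      rw [map_add, map_smul, h.hermitian.compat, hA1, inner_J_incl, smul_eq_mul, mul_one, add_zero]
    · change π (z.coeff • J A + ι z.base) = z.base
      have h0 : π (J A) = 0 := incl_injective (by
        rw [incl_proj, transverseProj_apply, h.hermitian.inner_J_self, h.hermitian.compat, hA1,
          map_zero]
        simp)
      rw [map_add, map_smul, h0, smul_zero, zero_add, proj_incl]
  right_inv v := Subtype.ext (by
    change B (J A) v • J A + ι (π v) = v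
    rw [incl_proj, transverseProj_apply, (hA v).symm.trans v.2]
    simp)

theorem incl_proj_lie (x : Transverse h hA hA1 hc) : ι (π ⁅A, ι x⁆) = ⁅A, ι x⁆ := by
  refine transverseProj_of_orthogonal (h.inner_lie hA _ _) ?_
  rw [h.inner_J_lie hA hA1, inner_J_incl, inner_incl, hA1, h.hermitian.inner.symm (J A) A,
    h.hermitian.inner_J_self]
  ring

variable (h hA hA1 hc)

/-- The restriction of `ad A` to the transverse algebra. -/
def derivation : LieDerivation ℝ (Transverse h hA hA1 hc) (Transverse h hA hA1 hc) where
  toLinearMap := π ∘ₗ LieAlgebra.ad ℝ g A ∘ₗ ι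
  leibniz' x y := by
    change π ⁅A, ι (π ⁅ι x, ι y⁆)⁆ =
      π ⁅ι x, ι (π ⁅A, ι y⁆)⁆ - π ⁅ι y, ι (π ⁅A, ι x⁆)⁆
    rw [proj_lie_proj_lie, proj_lie_proj_lie, proj_lie_proj_lie, leibniz_lie, map_add,
      ← lie_skew ⁅A, ι x⁆, map_neg]
    abel

variable {h hA hA1 hc}

theorem incl_derivation (x : Transverse h hA hA1 hc) :
    ι (derivation h hA hA1 hc x) = ⁅A, ι x⁆ :=
  incl_proj_lie x

theorem derivation_skew (x y : Transverse h hA hA1 hc) :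
    Bₜ (derivation h hA hA1 hc x) y = -Bₜ x (derivation h hA hA1 hc y) := by
  rw [inner_apply, inner_apply, incl_derivation, incl_derivation, h.ad_skew hA,
    h.hermitian.inner.symm (ι x)]

theorem derivation_complexStructure (x : Transverse h hA hA1 hc) :
    derivation h hA hA1 hc (Jₜ x) = Jₜ (derivation h hA hA1 hc x) :=
  incl_injective (by
    rw [incl_derivation, incl_complexStructure, incl_complexStructure, incl_derivation,
      h.lie_J hA])

/-- The derivation of the central extension that is `ad A` under `kerEquiv`. -/
def centralDerivation (hk : IsKahler Jₜ Bₜ) :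
    LieDerivation ℝ (CentralExtension hk.form) (CentralExtension hk.form) where
  -- No `ξ` component: `A` commutes with `J A`, and `ad A` preserves the transverse space.
  toFun z := ⟨0, derivation h hA hA1 hc z.base⟩
  map_add' z w := by ext <;> simp
  map_smul' c z := by ext <;> simp
  leibniz' z w := by
    ext
    · change 0 = Bₜ (Jₜ z.base) (derivation h hA hA1 hc w.base) -
        Bₜ (Jₜ w.base) (derivation h hA hA1 hc z.base)
      -- The Leibniz rule in the `ξ` component is invariance of `ω'`: the derivation is skew and
      -- commutes with the complex structure.
      have e1 := derivation_skew (Jₜ z.base) w.base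
      rw [derivation_complexStructure, hk.hermitian.skew, hk.hermitian.inner.symm _ (Jₜ w.base)]
        at e1
      linarith
    · change derivation h hA hA1 hc ⁅z.base, w.base⁆ = ⁅z.base, derivation h hA hA1 hc w.base⁆ -
        ⁅w.base, derivation h hA hA1 hc z.base⁆
      rw [LieDerivation.apply_lie_eq_sub]

theorem kerEquiv_centralDerivation (hk : IsKahler Jₜ Bₜ) (z : CentralExtension hk.form) :
    (kerEquiv hk (centralDerivation hk z) : g) = ⁅A, (kerEquiv hk z : g)⁆ := by
  change (0 : ℝ) • J A + ι (derivation h hA hA1 hc z.base) = ⁅A, z.coeff • J A + ι z.base⁆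
  rw [incl_derivation, lie_add, lie_smul, h.lie_J_self hA, zero_smul, smul_zero]

end Transverse

/-- Nondegeneracy of the transverse form: if `p` is the transverse part of `z`, then `⟨J A, [J p,
z]⟩ = -|p|²`, so a central `z` has `p = 0`. -/
theorem IsVaisman.mem_center_kerForm_iff (h : IsVaisman J B θ) (hA : ∀ x, θ x = B A x)
    (hA1 : B A A = 1) (hc : ∀ x : g, ⁅J A, x⁆ = 0) (z : kerForm θ h.lee_closed) :
    z ∈ LieAlgebra.center ℝ (kerForm θ h.lee_closed) ↔ (z : g) ∈ Submodule.span ℝ {J A} := by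
  have hH := h.hermitian
  rw [LieModule.mem_maxTrivSubmodule, Submodule.mem_span_singleton]
  constructor
  · intro hz
    have hzA : B A z = 0 := (hA z).symm.trans z.2
    set p := transverseProj J B A (z : g) with hp
    have hpA : B A p = 0 := hH.inner_transverseProj hA1 _
    have hpJ : B (J A) p = 0 := hH.inner_J_transverseProj hA1 _
    have hJp : B A (J p) = 0 := by
      rw [← neg_eq_zero, ← hH.skew, hpJ]
    have h0 : ⁅J p, (z : g)⁆ = 0 :=
      congrArg Subtype.val (hz ⟨J p, (hA _).trans hJp⟩)
    have h1 := h.inner_J_lie hA hA1 (J p) z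
    rw [h0, map_zero, hJp, hH.compat, hpA, hH.sq, map_neg, LinearMap.neg_apply, hp,
      ← transverseProj_of_orthogonal (x := transverseProj J B A (z : g)) hpA hpJ,
      hH.transverseProj_symm, ← hp] at h1
    have h2 : p = 0 := by
      by_contra hne
      have := hH.inner.pos _ hne
      linarith
    rw [hp, transverseProj_apply, hzA, zero_smul, sub_zero, sub_eq_zero] at h2
    exact ⟨_, h2.symm⟩
  · rintro ⟨c, hcz⟩ x
    refine Subtype.ext ?_
    change ⁅(x : g), (z : g)⁆ = 0
    rw [← hcz, lie_smul, lie_eq_zero_of_forall_lie_eq_zero hc, smul_zero]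

end Transverse

end VaismanLie

/-! ### The structure theorem. -/

open VaismanLie in
theorem theorem3 {g : Type u} [LieRing g] [LieAlgebra ℝ g] [FiniteDimensional ℝ g]
    [LieAlgebra.IsSolvable g] (hunim : IsUnimodular g)
    (J : g →ₗ[ℝ] g) (B : LinearMap.BilinForm ℝ g) (θ : Module.Dual ℝ g)
    (hV : IsVaisman J B θ)
    (A : g) (hA : ∀ x, θ x = B A x) (hA1 : B A A = 1) :
    (∀ z : kerForm θ hV.lee_closed,
      z ∈ LieAlgebra.center ℝ (kerForm θ hV.lee_closed) ↔ (z : g) ∈ Submodule.span ℝ {J A}) ∧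
    ∃ (k : Type u) (_ : LieRing k) (_ : LieAlgebra ℝ k)
      (J' : k →ₗ[ℝ] k) (B' : LinearMap.BilinForm ℝ k) (hk : IsKahlerFlat J' B')
      (ι : k →ₗ[ℝ] g),
      -- `k` is, as a Hermitian vector space, the orthogonal complement of `span {A, J A}`
      Function.Injective ι ∧
      (∀ v, v ∈ LinearMap.range ι ↔ B A v = 0 ∧ B (J A) v = 0) ∧
      (∀ x, ι (J' x) = J (ι x)) ∧
      (∀ x y, B' x y = B (ι x) (ι y)) ∧
      (∀ x y, hk.form.form x y = fundamentalForm J B (ι x) (ι y)) ∧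
      -- `ker θ = k_ω'(J A)`
      ∃ Φ : CentralExtension hk.form ≃ₗ⁅ℝ⁆ kerForm θ hV.lee_closed,
        (Φ (CentralExtension.gen hk.form) : g) = J A ∧
        (∀ x, (Φ (CentralExtension.incl hk.form x) : g) = ι x) ∧
        -- `D = ad A` on `ker θ`, and `g = k(D, ω')`
        ∃ D : LieDerivation ℝ (CentralExtension hk.form) (CentralExtension hk.form),
          (∀ z, (Φ (D z) : g) = ⁅A, (Φ z : g)⁆) ∧
          (∃ Ψ : DoubleExtension D ≃ₗ⁅ℝ⁆ g,
            Ψ (DoubleExtension.gen D) = A ∧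
            ∀ z, Ψ (DoubleExtension.incl D z) = (Φ z : g)) ∧
          -- `D' = D` restricted to `k`
          ∃ D' : LieDerivation ℝ k k,
            (∀ x, D (CentralExtension.incl hk.form x) = CentralExtension.incl hk.form (D' x)) ∧
            (∀ x y, B' (D' x) y = -B' x (D' y)) ∧
            (∀ x, D' (J' x) = J' (D' x)) := by
  have hc := hV.J_lie_eq_zero hunim hA hA1
  have hk : IsKahlerFlat (Transverse.complexStructure hV hA hA1 hc)
    (Transverse.inner hV hA hA1 hc) := Transverse.isKahlerFlat hunim
  refine ⟨hV.mem_center_kerForm_iff hA hA1 hc, Transverse hV hA hA1 hc, inferInstance,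
    inferInstance, Transverse.complexStructure hV hA hA1 hc, Transverse.inner hV hA hA1 hc, hk,
    Transverse.incl hV hA hA1 hc, Transverse.incl_injective, Transverse.mem_range_incl,
    Transverse.incl_complexStructure, Transverse.inner_apply, Transverse.fundamentalForm_apply,
    Transverse.kerEquiv hk.toIsKahler, ?_, fun x => ?_,
    Transverse.centralDerivation hk.toIsKahler, Transverse.kerEquiv_centralDerivation _, ?_,
    Transverse.derivation hV hA hA1 hc, fun x => rfl, Transverse.derivation_skew,
    Transverse.derivation_complexStructure⟩
  · change (1 : ℝ) • J A + Transverse.incl hV hA hA1 hc 0 = J A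
    rw [one_smul, map_zero, add_zero]
  · change (0 : ℝ) • J A + Transverse.incl hV hA hA1 hc x = Transverse.incl hV hA hA1 hc x
    rw [zero_smul, zero_add]
  · let Φ := Transverse.kerEquiv hk.toIsKahler
    refine DoubleExtension.exists_equiv _ ((kerForm θ hV.lee_closed).incl.comp Φ.toLieHom) A
      (Transverse.kerEquiv_centralDerivation _) (Subtype.val_injective.comp Φ.injective) θ
      ((hA A).trans hA1) fun x => ⟨fun hx => ⟨Φ.symm ⟨x, hx⟩, ?_⟩, ?_⟩
    · exact congrArg Subtype.val (Φ.apply_symm_apply ⟨x, hx⟩)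
    · rintro ⟨z, rfl⟩
      exact (Φ z).2
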